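/- An instance of the stable marriage problem consists of $n$ men, $n$ women and a profile $\succ$, which contains for every agent a preference list, i.e. a strict total order on the agents of the other side. For a profile $\succ$ let $\mathrm{DA}(\succ)$ be the matching computed by the men-proposing deferred acceptance algorithm: in every round each unmatched man proposes to his favourite woman among those who have not rejected him yet, and each woman tentatively keeps her favourite proposal and rejects the others, until nobody is rejected. Fix a profile $\succ$ and a man $m$ (the accomplice), and let $\mu=\mathrm{DA}(\succ)$. For a list $\succ'_m$ of the women let $\mu'=\mathrm{DA}(\succ_{-m},\succ'_m)$ be the matching that results when $m$ reports $\succ'_m$ instead of his true list $\succ_m$. The list $\succ'_m$ is a *no-regret* strategy if $\mu'(m)\succ_m\mu(m)$ or $\mu'(m)=\mu(m)$. An *optimal one-for-all strategy* for $m$ is a no-regret strategy $\succ'_m$ such that every woman weakly prefers (according to her list in $\succ$) her partner in $\mu'$ to her partner in $\mu$, and also to her partner in $\mathrm{DA}(\succ_{-m},\succ''_m)$ for every no-regret strategy $\succ''_m$. A list arises from $\succ_m$ by *pushing up* a set $X$ of women if the women above $\mu(m)$ in it are those above $\mu(m)$ in $\succ_m$ together with those in $X\setminus\{\mu(m)\}$,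 the order within the part above $\mu(m)$ and within the part below $\mu(m)$ being arbitrary. Let $W^{\mathrm{NR}}$ be the set of all women $w$ such that pushing up $\{w\}$ (in whatever order) gives a no-regret strategy. **Theorem.** There is an algorithm which, given $n$, the $2n$ preference lists of a profile $\succ$ and a man $m$, computes in $O(n^3)$ time the set $W^{\mathrm{NR}}$ and a list $\succ'_m$ that arises from $\succ_m$ by pushing up $W^{\mathrm{NR}}$ and is an optimal one-for-all strategy for the accomplice $m$. Here running time is measured on a random access machine with unit-cost addition, truncated subtraction, multiplication, comparison and memory access, whose words are the integers from $0$ to $C n^2$ for a constant $C$ (words of $O(\log n)$ bits); the program and the constants do not depend on $n$, $\succ$ and $m$. -/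

import Mathlib

namespace OneForAll

/-! ### Stable marriage instances

The `n` men and the `n` women are both labelled by `Fin n`. -/

/-- A preference list (a strict total order on `n` agents): `l k` is the agent in position `k`,
position `0` being the most preferred one. -/
abbrev PrefList (n : ℕ) := Equiv.Perm (Fin n)

/-- `l.Prefers a b`: the list `l` ranks `a` strictly above `b`. -/
def PrefList.Prefers {n : ℕ} (l : PrefList n) (a b : Fin n) : Prop := l.symm a < l.symm b

/-- `l.WeakPrefers a b`: `a` is strictly above `b` in the list `l`, or `a = b`. -/
def PrefList.WeakPrefers {n : ℕ} (l : PrefList n) (a b : Fin n) : Prop := l.Prefers a b ∨ a = b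

/-- A preference profile: a list of women for every man, and a list of men for every woman. -/
structure Profile (n : ℕ) where
  men : Fin n → PrefList n
  women : Fin n → PrefList n

/-- The profile in which man `m` reports the list `σ` and nobody else changes their list. -/
def Profile.report {n : ℕ} (P : Profile n) (m : Fin n) (σ : PrefList n) : Profile n where
  men := Function.update P.men m σ
  women := P.women

/-! ### The men-proposing deferred acceptance algorithm

A state of the algorithm is the function `k` giving, for every man, the number of women who
have rejected him so far.  As a man proposes in the order of his list, these women are the first
`k m` women of his list, and his standing proposal is to the woman in position `k m`. -/

/-- In state `k` the standing proposal of man `m` is to woman `w`. -/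
def Proposes {n : ℕ} (P : Profile n) (k : Fin n → ℕ) (m w : Fin n) : Prop :=
  (((P.men m).symm w : Fin n) : ℕ) = k m

/-- In state `k` man `m` is rejected: the woman he proposes to has a proposal from a man
whom she prefers to `m`. -/
def IsRejected {n : ℕ} (P : Profile n) (k : Fin n → ℕ) (m : Fin n) : Prop :=
  ∃ w m', Proposes P k m w ∧ Proposes P k m' w ∧ (P.women w).Prefers m' m

open Classical in
/-- One round: every woman keeps her favourite proposal and rejects the other ones. -/
noncomputable def daRound {n : ℕ} (P : Profile n) (k : Fin n → ℕ) : Fin n → ℕ :=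
  fun m => if IsRejected P k m then k m + 1 else k m

/-- The state after `r` rounds, starting without any rejection. -/
noncomputable def daState {n : ℕ} (P : Profile n) (r : ℕ) : Fin n → ℕ := (daRound P)^[r] 0

/-- The terminal state. (Every round but the terminal ones has a new rejection, so that
`n * n` rounds are enough; see `daFinal_fixed`.) -/
noncomputable def daFinal {n : ℕ} (P : Profile n) : Fin n → ℕ := daState P (n * n)

theorem daState_succ {n : ℕ} (P : Profile n) (r : ℕ) :
    daState P (r + 1) = daRound P (daState P r) :=
  Function.iterate_succ_apply' _ _ _

/-- A woman with a proposal still has one after the round. -/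
theorem exists_proposes_daRound {n : ℕ} (P : Profile n) (k : Fin n → ℕ) {m w : Fin n}
    (h : Proposes P k m w) : ∃ m', Proposes P (daRound P k) m' w := by
  classical
  obtain ⟨m', hm', hbest⟩ := Finset.exists_min_image
    (Finset.univ.filter fun x => Proposes P k x w) (fun x => (P.women w).symm x)
    ⟨m, by simpa using h⟩
  have hp : Proposes P k m' w := by simpa using hm'
  refine ⟨m', ?_⟩
  have hnr : ¬ IsRejected P k m' := by
    rintro ⟨w', m'', h1, h2, h3⟩
    have hw : w' = w := by
      apply (P.men m').symm.injective
      apply Fin.ext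
      unfold Proposes at h1 hp
      rw [h1, hp]
    subst hw
    have := hbest m'' (by simpa using h2)
    exact absurd h3 (not_lt.mpr this)
  unfold Proposes daRound
  rw [if_neg hnr]
  exact hp

/-- A woman who has rejected somebody has a proposal. -/
theorem exists_proposes_of_lt {n : ℕ} (P : Profile n) (r : ℕ) (m w : Fin n)
    (h : (((P.men m).symm w : Fin n) : ℕ) < daState P r m) :
    ∃ m', Proposes P (daState P r) m' w := by
  classical
  induction r generalizing m w with
  | zero => simp [daState] at h
  | succ r ih =>
    rw [daState_succ] at h ⊢
    by_cases h1 : (((P.men m).symm w : Fin n) : ℕ) < daState P r m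
    · obtain ⟨m', hm'⟩ := ih m w h1
      exact exists_proposes_daRound P _ hm'
    · have : Proposes P (daState P r) m w := by
        unfold daRound at h
        unfold Proposes
        split_ifs at h <;> omega
      exact exists_proposes_daRound P _ this

/-- No man is rejected by all the women. -/
theorem daState_lt {n : ℕ} (P : Profile n) (r : ℕ) (m : Fin n) : daState P r m < n := by
  by_contra hcon
  push Not at hcon
  have hex : ∀ w, ∃ m', Proposes P (daState P r) m' w := fun w =>
    exists_proposes_of_lt P r m w (lt_of_lt_of_le (Fin.is_lt _) hcon)
  choose f hf using hex
  have hinj : Function.Injective f := by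
    intro a b hab
    have ha := hf a
    have hb := hf b
    rw [← hab] at hb
    unfold Proposes at ha hb
    exact (P.men (f a)).symm.injective (Fin.ext (ha.trans hb.symm))
  obtain ⟨w, hw⟩ := (Finite.injective_iff_surjective.mp hinj) m
  have h := hf w
  rw [hw] at h
  unfold Proposes at h
  have := ((P.men m).symm w).is_lt
  omega

/-- The terminal state is terminal: nobody is rejected any more. -/
theorem daFinal_fixed {n : ℕ} (P : Profile n) : ∀ m, ¬ IsRejected P (daFinal P) m := by
  classical
  have key : ∀ r, (∀ m, ¬ IsRejected P (daState P r) m) ∨ r ≤ ∑ m, daState P r m := by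
    intro r
    induction r with
    | zero => right; exact Nat.zero_le _
    | succ r ih =>
      rw [daState_succ]
      by_cases hfix : ∀ m, ¬ IsRejected P (daState P r) m
      · left
        have : daRound P (daState P r) = daState P r := by
          funext m
          exact if_neg (hfix m)
        rwa [this]
      · right
        have hr := ih.resolve_left hfix
        push Not at hfix
        obtain ⟨m₀, h0⟩ := hfix
        have hlt : ∑ m, daState P r m < ∑ m, daRound P (daState P r) m := by
          apply Finset.sum_lt_sum
          · intro m _
            unfold daRound
            split_ifs <;> omega
          · refine ⟨m₀, Finset.mem_univ _, ?_⟩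
            unfold daRound
            rw [if_pos h0]
            omega
        omega
  rcases key (n * n) with h | h
  · exact h
  · intro m
    exfalso
    have hlt : ∑ i, daState P (n * n) i < ∑ _i : Fin n, n :=
      Finset.sum_lt_sum_of_nonempty ⟨m, Finset.mem_univ _⟩ (fun i _ => daState_lt P _ i)
    simp at hlt
    omega

/-- The woman to whom man `m` is engaged in the terminal state. -/
noncomputable def daPartner {n : ℕ} (P : Profile n) (m : Fin n) : Fin n :=
  P.men m ⟨daFinal P m, daState_lt P _ m⟩

theorem daPartner_bijective {n : ℕ} (P : Profile n) : Function.Bijective (daPartner P) := by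
  apply Finite.injective_iff_bijective.mp
  have hprop : ∀ m, Proposes P (daFinal P) m (daPartner P m) := by
    intro m
    simp [Proposes, daPartner]
  intro a b hab
  by_contra hne
  have ha := hprop a
  have hb := hprop b
  rw [← hab] at hb
  rcases lt_or_gt_of_ne (fun h => hne ((P.women (daPartner P a)).symm.injective h)) with h | h
  · exact daFinal_fixed P b ⟨_, a, hb, ha, h⟩
  · exact daFinal_fixed P a ⟨_, b, ha, hb, h⟩

/-- The matching computed by deferred acceptance: `DA P m` is the partner of man `m` and
`(DA P).symm w` is the partner of woman `w`. -/
noncomputable def DA {n : ℕ} (P : Profile n) : Fin n ≃ Fin n :=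
  Equiv.ofBijective (daPartner P) (daPartner_bijective P)

/-! ### One-for-all strategies of an accomplice -/

/-- The accomplice `m` does not incur regret by reporting `σ`. -/
def NoRegret {n : ℕ} (P : Profile n) (m : Fin n) (σ : PrefList n) : Prop :=
  (P.men m).WeakPrefers (DA (P.report m σ) m) (DA P m)

/-- All women weakly prefer the matching `μ` to the matching `ν`, by their lists in `P`. -/
def WomenWeakPrefer {n : ℕ} (P : Profile n) (μ ν : Fin n ≃ Fin n) : Prop :=
  ∀ w, (P.women w).WeakPrefers (μ.symm w) (ν.symm w)

/-- `σ` is an optimal one-for-all strategy of the accomplice `m`, among all the lists that he can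
report without incurring regret. -/
structure IsOptimalStrategy {n : ℕ} (P : Profile n) (m : Fin n) (σ : PrefList n) : Prop where
  noRegret : NoRegret P m σ
  improves : WomenWeakPrefer P (DA (P.report m σ)) (DA P)
  optimal : ∀ τ : PrefList n, NoRegret P m τ →
    WomenWeakPrefer P (DA (P.report m σ)) (DA (P.report m τ))

/-- The list `σ` arises from the true list of `m` by pushing up the set `X`: the women above
`DA P m` in `σ` are those above `DA P m` in the true list and those in `X` (other than `DA P m`
itself).  The order inside the part above and inside the part below `DA P m` is left open. -/
def IsPushUp {n : ℕ} (P : Profile n) (m : Fin n) (X : Set (Fin n)) (σ : PrefList n) : Prop :=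
  ∀ w, w ≠ DA P m → (σ.Prefers w (DA P m) ↔ ((P.men m).Prefers w (DA P m) ∨ w ∈ X))

/-- The no-regret set: the women whom `m` can push up individually without incurring regret. -/
def noRegretSet {n : ℕ} (P : Profile n) (m : Fin n) : Set (Fin n) :=
  {w | ∀ σ : PrefList n, IsPushUp P m {w} σ → NoRegret P m σ}

/-! ### Random access machine programs

Words are natural numbers of bounded size.  A program works on registers and on arrays of
words, both named by fixed numbers in the program text (so that a program uses finitely many of
them); an array cell is addressed by a computed word.  Every operation costs one step. -/

/-- Contents `reg x` of register `x` and contents `arr a i` of cell `i` of array `a`. -/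
structure State where
  reg : ℕ → ℕ
  arr : ℕ → ℕ → ℕ

/-- Operations on words; subtraction is truncated at `0`, comparisons return `1` or `0`. -/
inductive Op where
  | add | sub | mul | lt | eq

def Op.eval : Op → ℕ → ℕ → ℕ
  | .add, a, b => a + b
  | .sub, a, b => a - b
  | .mul, a, b => a * b
  | .lt, a, b => if a < b then 1 else 0
  | .eq, a, b => if a = b then 1 else 0

/-- Expressions: a literal, the contents of a register, the contents of the cell of a given array
at a computed address, or an operation. -/
inductive Expr where
  | lit (c : ℕ)
  | reg (x : ℕ)
  | read (a : ℕ) (i : Expr)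
  | bin (o : Op) (e f : Expr)

def Expr.eval (s : State) : Expr → ℕ
  | .lit c => c
  | .reg x => s.reg x
  | .read a i => s.arr a (i.eval s)
  | .bin o e f => o.eval (e.eval s) (f.eval s)

/-- The number of steps for evaluating an expression: one for every node. -/
def Expr.cost : Expr → ℕ
  | .lit _ => 1
  | .reg _ => 1
  | .read _ i => i.cost + 1
  | .bin _ e f => e.cost + f.cost + 1

/-- All values (and addresses) that occur in evaluating the expression are words, that is, at
most `B`. -/
def Expr.Fits (B : ℕ) (s : State) : Expr → Prop
  | .lit c => c ≤ B
  | .reg x => s.reg x ≤ B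
  | .read a i => i.Fits B s ∧ s.arr a (i.eval s) ≤ B
  | .bin o e f => e.Fits B s ∧ f.Fits B s ∧ o.eval (e.eval s) (f.eval s) ≤ B

/-- Programs. A test succeeds if its expression has a non-zero value. -/
inductive Prog where
  | skip
  | assign (x : ℕ) (e : Expr)
  | write (a : ℕ) (i e : Expr)
  | seq (p q : Prog)
  | cond (e : Expr) (p q : Prog)
  | loop (e : Expr) (p : Prog)

def State.setReg (s : State) (x v : ℕ) : State where
  reg := Function.update s.reg x v
  arr := s.arr

def State.setArr (s : State) (a i v : ℕ) : State where
  reg := s.reg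
  arr := Function.update s.arr a (Function.update (s.arr a) i v)

/-- `Exec B p s s' t`: on a machine whose words are the numbers up to `B`, the program `p`, started
in state `s`, halts in state `s'` after exactly `t` steps, without any overflow. -/
inductive Exec (B : ℕ) : Prog → State → State → ℕ → Prop where
  | skip (s : State) : Exec B .skip s s 1
  | assign (s : State) (x : ℕ) (e : Expr) (he : e.Fits B s) :
      Exec B (.assign x e) s (s.setReg x (e.eval s)) (e.cost + 1)
  | write (s : State) (a : ℕ) (i e : Expr) (hi : i.Fits B s) (he : e.Fits B s) :
      Exec B (.write a i e) s (s.setArr a (i.eval s) (e.eval s)) (i.cost + e.cost + 1)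
  | seq {p q : Prog} {s₁ s₂ s₃ : State} {t₁ t₂ : ℕ}
      (h₁ : Exec B p s₁ s₂ t₁) (h₂ : Exec B q s₂ s₃ t₂) :
      Exec B (.seq p q) s₁ s₃ (t₁ + t₂)
  | condTrue {e : Expr} {p q : Prog} {s s' : State} {t : ℕ} (hf : e.Fits B s)
      (he : e.eval s ≠ 0) (h : Exec B p s s' t) :
      Exec B (.cond e p q) s s' (e.cost + 1 + t)
  | condFalse {e : Expr} {p q : Prog} {s s' : State} {t : ℕ} (hf : e.Fits B s)
      (he : e.eval s = 0) (h : Exec B q s s' t) :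
      Exec B (.cond e p q) s s' (e.cost + 1 + t)
  | loopTrue {e : Expr} {p : Prog} {s₁ s₂ s₃ : State} {t₁ t₂ : ℕ} (hf : e.Fits B s₁)
      (he : e.eval s₁ ≠ 0) (h₁ : Exec B p s₁ s₂ t₁) (h₂ : Exec B (.loop e p) s₂ s₃ t₂) :
      Exec B (.loop e p) s₁ s₃ (e.cost + 1 + t₁ + t₂)
  | loopFalse {e : Expr} {p : Prog} {s : State} (hf : e.Fits B s) (he : e.eval s = 0) :
      Exec B (.loop e p) s s (e.cost + 1)

/-- Execution is deterministic: final state and number of steps are determined by the start. -/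
theorem Exec.deterministic {B : ℕ} {p : Prog} {s s₁ : State} {t₁ : ℕ} (h : Exec B p s s₁ t₁) :
    ∀ {s₂ : State} {t₂ : ℕ}, Exec B p s s₂ t₂ → s₁ = s₂ ∧ t₁ = t₂ := by
  induction h with
  | skip s => intro _ _ h'; cases h'; exact ⟨rfl, rfl⟩
  | assign s x e he => intro _ _ h'; cases h'; exact ⟨rfl, rfl⟩
  | write s a i e hi he => intro _ _ h'; cases h'; exact ⟨rfl, rfl⟩
  | seq _ _ ih₁ ih₂ =>
    intro _ _ h'
    cases h' with
    | seq k₁ k₂ =>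
      obtain ⟨rfl, rfl⟩ := ih₁ k₁
      obtain ⟨rfl, rfl⟩ := ih₂ k₂
      exact ⟨rfl, rfl⟩
  | condTrue hf he _ ih =>
    intro _ _ h'
    cases h' with
    | condTrue _ _ k => obtain ⟨rfl, rfl⟩ := ih k; exact ⟨rfl, rfl⟩
    | condFalse _ he' _ => exact absurd he' he
  | condFalse hf he _ ih =>
    intro _ _ h'
    cases h' with
    | condTrue _ he' _ => exact absurd he he'
    | condFalse _ _ k => obtain ⟨rfl, rfl⟩ := ih k; exact ⟨rfl, rfl⟩
  | loopTrue hf he _ _ ih₁ ih₂ =>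
    intro _ _ h'
    cases h' with
    | loopTrue _ _ k₁ k₂ =>
      obtain ⟨rfl, rfl⟩ := ih₁ k₁
      obtain ⟨rfl, rfl⟩ := ih₂ k₂
      exact ⟨rfl, rfl⟩
    | loopFalse _ he' => exact absurd he' he
  | loopFalse hf he =>
    intro _ _ h'
    cases h' with
    | loopTrue _ he' _ _ => exact absurd he he'
    | loopFalse _ _ => exact ⟨rfl, rfl⟩

/-! ### Input and output -/

/-- Preference lists as a table, row by row: cell `i * n + j` holds the label of the agent in
position `j` of the list of agent `i`; all cells from `n * n` on hold `0`. -/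
def table {n : ℕ} (T : Fin n → PrefList n) (i : ℕ) : ℕ :=
  if h : i < n * n then
    ((T (Fin.divNat (⟨i, h⟩ : Fin (n * n))) (Fin.modNat (⟨i, h⟩ : Fin (n * n))) : Fin n) : ℕ)
  else 0

/-- The input: register `0` holds `n`, register `1` the label of the accomplice, array `0` the
lists of the men, array `1` the lists of the women; everything else is `0`. -/
def inputState {n : ℕ} (P : Profile n) (m : Fin n) : State where
  reg x := if x = 0 then n else if x = 1 then (m : ℕ) else 0
  arr a i := if a = 0 then table P.men i else if a = 1 then table P.women i else 0

/-- Array `2` of the state holds the list `σ`. -/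
def OutputsList {n : ℕ} (s : State) (σ : PrefList n) : Prop :=
  ∀ k : Fin n, s.arr 2 k = ((σ k : Fin n) : ℕ)

/-- Array `3` of the state holds the indicator function of the set `X`. -/
def OutputsSet {n : ℕ} (s : State) (X : Set (Fin n)) : Prop :=
  ∀ w : Fin n, (w ∈ X → s.arr 3 w = 1) ∧ (w ∉ X → s.arr 3 w = 0)

end OneForAll

/-!
The outcome of deferred acceptance does not depend on the order of the proposals: the numbers of
women who have rejected each man form the least vector that is closed under rejections. Now let the
accomplice `m` propose to all the women of a set `X` at once, and run deferred acceptance of the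
other men. Its rejections are monotone in `X`, and if `X` consists of the women to whom `m` proposes
under some report, the outcome for the women is that of the report.

Call a woman a rejector if she rejects `m` when his first proposal is to her. By monotonicity she
rejects him whatever other proposals he makes as well. Conversely, suppose that `m` proposes to a
set `X` and is rejected by all of it, but that some `y` in `X` is not a rejector. When `m` proposes
to `y` alone, she keeps him and nobody is left out, so that every woman has a proposal. By
monotonicity this remains true for `X`, and all `n` women hold men other than `m`, although there
are only `n - 1` such men. Hence a report is no-regret if and only if all the women above `DA P m`
in it are rejectors, and the no-regret set consists of the rejectors and `DA P m`. The women are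
best off when `m` proposes to as many rejectors as possible, so pushing up all of them is optimal.

Since the order of the proposals is irrelevant, each woman is tested by a run in which the men enter
one after the other. It takes `O(n²)` steps, which makes `O(n³)` steps for all the women.
-/

namespace OneForAll

variable {n : ℕ}

/-! ### Deferred acceptance -/

/-- The position of the agent `a` in the list `l`, as a natural number. -/
def PrefList.pos (l : PrefList n) (a : Fin n) : ℕ := (l.symm a : Fin n)

theorem PrefList.pos_lt (l : PrefList n) (a : Fin n) : l.pos a < n := (l.symm a).is_lt

theorem PrefList.pos_injective (l : PrefList n) : Function.Injective l.pos :=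
  Fin.val_injective.comp l.symm.injective

theorem PrefList.pos_apply (l : PrefList n) (k : Fin n) : l.pos (l k) = k := by
  simp [PrefList.pos]

theorem PrefList.prefers_iff {l : PrefList n} {a b : Fin n} : l.Prefers a b ↔ l.pos a < l.pos b :=
  Iff.rfl

theorem PrefList.exists_best (l : PrefList n) {p : Fin n → Prop} (h : ∃ a, p a) :
    ∃ a, p a ∧ ∀ b, p b → ¬ l.Prefers b a :=
  (measure l.pos).wf.has_min {a | p a} h

theorem proposes_iff {P : Profile n} {k : Fin n → ℕ} {i w : Fin n} :
    Proposes P k i w ↔ (P.men i).pos w = k i :=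
  Iff.rfl

theorem daState_le_daState_succ (P : Profile n) (r : ℕ) (i : Fin n) :
    daState P r i ≤ daState P (r + 1) i := by
  rw [daState_succ, daRound]
  split_ifs <;> omega

theorem daState_succ_le (P : Profile n) (r : ℕ) (i : Fin n) :
    daState P (r + 1) i ≤ daState P r i + 1 := by
  rw [daState_succ, daRound]
  split_ifs <;> omega

theorem exists_proposes_daRound_not_prefers (P : Profile n) (k : Fin n → ℕ) {i w : Fin n}
    (h : Proposes P k i w) :
    ∃ i', Proposes P (daRound P k) i' w ∧ ¬ (P.women w).Prefers i i' := by
  obtain ⟨i', hi', hbest⟩ := (P.women w).exists_best (p := (Proposes P k · w)) ⟨i, h⟩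
  have hkept : ¬ IsRejected P k i' := by
    rintro ⟨w', j, hw', hj, hpref⟩
    obtain rfl : w' = w := (P.men i').pos_injective (hw'.trans hi'.symm)
    exact hbest j hj hpref
  exact ⟨i', by rwa [proposes_iff, daRound, if_neg hkept], hbest i h⟩

theorem exists_proposes_not_prefers (P : Profile n) (r : ℕ) (i w : Fin n)
    (h : (P.men i).pos w ≤ daState P r i) :
    ∃ i', Proposes P (daState P r) i' w ∧ ¬ (P.women w).Prefers i i' := by
  induction r generalizing i w with
  | zero => exact ⟨i, Nat.le_zero.1 h, lt_irrefl _⟩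
  | succ r ih =>
    by_cases hold : (P.men i).pos w ≤ daState P r i
    · obtain ⟨j, hj, hij⟩ := ih i w hold
      obtain ⟨i', hi', hji'⟩ := exists_proposes_daRound_not_prefers P _ hj
      exact ⟨i', by rwa [daState_succ], not_lt.2 ((not_lt.1 hji').trans (not_lt.1 hij))⟩
    · have := daState_succ_le P r i
      exact ⟨i, by rw [proposes_iff]; omega, lt_irrefl _⟩

theorem not_prefers_of_proposes_daFinal (P : Profile n) {i j w : Fin n}
    (hi : Proposes P (daFinal P) i w) (hj : (P.men j).pos w ≤ daFinal P j) :
    ¬ (P.women w).Prefers j i := by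
  intro hpref
  obtain ⟨j', hj', hle⟩ := exists_proposes_not_prefers P (n * n) j w hj
  exact daFinal_fixed P i ⟨w, j', hi, hj', (not_lt.1 hle).trans_lt hpref⟩

theorem proposes_DA (P : Profile n) (i : Fin n) : Proposes P (daFinal P) i (DA P i) := by
  simp [Proposes, DA, daPartner]

theorem exists_daState_eq_isRejected (P : Profile n) (i : Fin n) {p : ℕ} (hp : p < daFinal P i) :
    ∃ r, daState P r i = p ∧ IsRejected P (daState P r) i := by
  obtain ⟨r, -, hr, hr'⟩ : ∃ r < n * n, daState P r i ≤ p ∧ p < daState P (r + 1) i := by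
    by_contra! hstay
    have hle : ∀ r ≤ n * n, daState P r i ≤ p := fun r hr => by
      induction r with
      | zero => exact Nat.zero_le p
      | succ r ih => exact hstay r (by omega) (ih (by omega))
    exact absurd hp (not_lt.2 (hle _ le_rfl))
  rw [daState_succ, daRound] at hr'
  split_ifs at hr' with hrej
  · exact ⟨r, by omega, hrej⟩
  · omega

/-! ### Fixed proposals of the accomplice -/

/-- Man `i` has proposed to woman `w`, in the situation where man `m` has proposed to the women in
`X` and every other man `j` to the first `k j + 1` women of his list. -/
def HasProposed (P : Profile n) (m : Fin n) (X : Set (Fin n)) (k : Fin n → ℕ) (i w : Fin n) :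
    Prop :=
  (i = m ∧ w ∈ X) ∨ (i ≠ m ∧ (P.men i).pos w ≤ k i)

/-- In the situation of `HasProposed`, woman `w` has a proposal that she prefers to man `i`. -/
def Beaten (P : Profile n) (m : Fin n) (X : Set (Fin n)) (k : Fin n → ℕ) (i w : Fin n) : Prop :=
  ∃ j, HasProposed P m X k j w ∧ (P.women w).Prefers j i

/-- In the situation of `HasProposed`, the last proposals of the men other than `m` are not
rejected. -/
def ClosedCounts (P : Profile n) (m : Fin n) (X : Set (Fin n)) (k : Fin n → ℕ) : Prop :=
  ∀ i, i ≠ m → ∀ w, Proposes P k i w → ¬ Beaten P m X k i w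

/-- The outcome of deferred acceptance of the men other than `m` while `m` proposes to all the
women in `X`, as the pointwise least closed numbers of rejections. The value at `m` is `0`, and the
value `n` stands for a man who is rejected by all the women. -/
noncomputable def leastCounts (P : Profile n) (m : Fin n) (X : Set (Fin n)) (i : Fin n) : ℕ :=
  sInf {a | ∃ k, ClosedCounts P m X k ∧ k i = a}

/-- The women who reject `m` in deferred acceptance if his first proposal is to them. -/
def rejectors (P : Profile n) (m : Fin n) : Set (Fin n) :=
  {w | Beaten P m {w} (leastCounts P m {w}) m w}

section LeastCounts

variable {P : Profile n} {m : Fin n} {X Y : Set (Fin n)} {k l : Fin n → ℕ} {i w : Fin n}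

theorem HasProposed.mono (hX : X ⊆ Y) (hk : ∀ j, j ≠ m → k j ≤ l j)
    (h : HasProposed P m X k i w) : HasProposed P m Y l i w :=
  h.imp (fun h => ⟨h.1, hX h.2⟩) (fun h => ⟨h.1, h.2.trans (hk i h.1)⟩)

theorem Beaten.mono (hX : X ⊆ Y) (hk : ∀ j, j ≠ m → k j ≤ l j) :
    Beaten P m X k i w → Beaten P m Y l i w :=
  fun ⟨j, hj, hpref⟩ => ⟨j, hj.mono hX hk, hpref⟩

theorem hasProposed_of_proposes (hm : i = m → w ∈ X) (hk : ∀ j, j ≠ m → k j ≤ l j)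
    (h : Proposes P k i w) : HasProposed P m X l i w := by
  by_cases hi : i = m
  · exact Or.inl ⟨hi, hm hi⟩
  · exact Or.inr ⟨hi, (proposes_iff.1 h).trans_le (hk i hi)⟩

theorem leastCounts_le (hk : ClosedCounts P m X k) (i : Fin n) : leastCounts P m X i ≤ k i :=
  Nat.sInf_le ⟨k, hk, rfl⟩

variable (P m X) in
theorem closedCounts_const : ClosedCounts P m X fun _ => n :=
  fun j _ v hv => absurd hv ((P.men j).pos_lt v).ne

variable (P m X) in
theorem leastCounts_le_card (i : Fin n) : leastCounts P m X i ≤ n :=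
  leastCounts_le (closedCounts_const P m X) i

variable (P m X) in
theorem closedCounts_leastCounts : ClosedCounts P m X (leastCounts P m X) := by
  intro i hi w hw hbeaten
  obtain ⟨k, hk, hki⟩ : ∃ k, ClosedCounts P m X k ∧ k i = leastCounts P m X i :=
    Nat.sInf_mem (s := {a | ∃ k, ClosedCounts P m X k ∧ k i = a})
      ⟨n, _, closedCounts_const P m X, rfl⟩
  exact hk i hi w (hw.trans hki.symm) (hbeaten.mono subset_rfl fun j _ => leastCounts_le hk j)

variable (P m) in
theorem leastCounts_mono (h : X ⊆ Y) (i : Fin n) : leastCounts P m X i ≤ leastCounts P m Y i :=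
  leastCounts_le (fun i hi w hw hbeaten =>
    closedCounts_leastCounts P m Y i hi w hw (hbeaten.mono h fun _ _ => le_rfl)) i

/- Otherwise lowering the count of `i` to the position of `w` would leave the counts closed. -/
theorem beaten_of_lt_leastCounts (hi : i ≠ m) (hw : (P.men i).pos w < leastCounts P m X i) :
    Beaten P m X (leastCounts P m X) i w := by
  by_contra hkept
  set l := Function.update (leastCounts P m X) i ((P.men i).pos w) with hl
  have hli : l i = (P.men i).pos w := Function.update_self ..
  have hlj : ∀ j, j ≠ i → l j = leastCounts P m X j := fun j hj => Function.update_of_ne hj ..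
  have hle : ∀ j, j ≠ m → l j ≤ leastCounts P m X j := by
    intro j _
    rcases eq_or_ne j i with rfl | hj
    · exact hli.trans_le hw.le
    · exact (hlj j hj).le
  have hclosed : ClosedCounts P m X l := by
    intro j hj v hv hbeaten
    rw [proposes_iff] at hv
    rcases eq_or_ne j i with rfl | hji
    · obtain rfl : v = w := (P.men j).pos_injective (hv.trans hli)
      exact hkept (hbeaten.mono subset_rfl hle)
    · exact closedCounts_leastCounts P m X j hj v (hv.trans (hlj j hji))
        (hbeaten.mono subset_rfl hle)
  exact absurd (leastCounts_le hclosed i) (not_le.2 (hli.trans_lt hw))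

theorem HasProposed.pos_eq_leastCounts (hi : i ≠ m)
    (h : HasProposed P m X (leastCounts P m X) i w)
    (hkept : ¬ Beaten P m X (leastCounts P m X) i w) :
    (P.men i).pos w = leastCounts P m X i := by
  rcases h with ⟨him, -⟩ | ⟨-, hle⟩
  · exact absurd him hi
  · exact hle.antisymm (not_lt.1 fun hlt => hkept (beaten_of_lt_leastCounts hi hlt))

/- If `m` were rejected by all of `X`, the `n` women would hold proposals of `n` men other than
`m`. -/
theorem exists_not_beaten_of_forall_hasProposed
    (h : ∀ w, ∃ i, HasProposed P m X (leastCounts P m X) i w) :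
    ∃ w ∈ X, ¬ Beaten P m X (leastCounts P m X) m w := by
  by_contra! hrejected
  have hbest : ∀ w, ∃ i, HasProposed P m X (leastCounts P m X) i w ∧
      ¬ Beaten P m X (leastCounts P m X) i w := fun w => by
    obtain ⟨i, hi, hbest⟩ := (P.women w).exists_best (h w)
    exact ⟨i, hi, fun ⟨j, hj, hpref⟩ => hbest j hj hpref⟩
  choose f hf hkept using hbest
  have hfm : ∀ w, f w ≠ m := fun w hw => by
    rcases hf w with ⟨-, hX⟩ | ⟨hne, -⟩
    · exact hkept w (hw ▸ hrejected w hX)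
    · exact hne hw
  have hlast : ∀ w, (P.men (f w)).pos w = leastCounts P m X (f w) :=
    fun w => (hf w).pos_eq_leastCounts (hfm w) (hkept w)
  have hinj : Function.Injective f := fun a b hab =>
    (P.men (f a)).pos_injective ((hlast a).trans (by rw [hab, hlast b]))
  obtain ⟨w, hw⟩ := Finite.injective_iff_surjective.mp hinj m
  exact hfm w hw

theorem daState_le_leastCounts {r : ℕ} (hX : ∀ w, (P.men m).pos w ≤ daState P r m → w ∈ X)
    (hi : i ≠ m) : daState P r i ≤ leastCounts P m X i := by
  induction r generalizing i with
  | zero => exact Nat.zero_le _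
  | succ r ih =>
    have hX' : ∀ w, (P.men m).pos w ≤ daState P r m → w ∈ X :=
      fun w hw => hX w (hw.trans (daState_le_daState_succ P r m))
    rw [daState_succ, daRound]
    split_ifs with hrej
    · refine Nat.succ_le_of_lt ((ih hX' hi).lt_of_ne fun heq => ?_)
      obtain ⟨w, j, hiw, hjw, hpref⟩ := hrej
      exact closedCounts_leastCounts P m X i hi w (hiw.trans heq)
        ⟨j, hasProposed_of_proposes (fun h => hX' w (h ▸ hjw.le)) (fun _ => ih hX') hjw, hpref⟩
    · exact ih hX' hi

end LeastCounts

/-- The women to whom man `m` proposes in the course of deferred acceptance. -/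
def proposedSet (P : Profile n) (m : Fin n) : Set (Fin n) := {w | (P.men m).pos w ≤ daFinal P m}

theorem mem_proposedSet_iff {P : Profile n} {m w : Fin n} :
    w ∈ proposedSet P m ↔ ¬ (P.men m).Prefers (DA P m) w := by
  rw [PrefList.prefers_iff, not_lt, proposes_iff.1 (proposes_DA P m)]
  rfl

theorem not_beaten_daFinal (P : Profile n) {m i w : Fin n} (h : Proposes P (daFinal P) i w) :
    ¬ Beaten P m (proposedSet P m) (daFinal P) i w := by
  rintro ⟨j, hj, hpref⟩
  refine not_prefers_of_proposes_daFinal P h ?_ hpref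
  rcases hj with ⟨rfl, hw⟩ | ⟨-, hw⟩ <;> exact hw

theorem leastCounts_le_daFinal (P : Profile n) (m i : Fin n) :
    leastCounts P m (proposedSet P m) i ≤ daFinal P i :=
  leastCounts_le (fun _ _ _ => not_beaten_daFinal P) i

theorem daFinal_eq_leastCounts (P : Profile n) {m i : Fin n} (hi : i ≠ m) :
    daFinal P i = leastCounts P m (proposedSet P m) i :=
  (daState_le_leastCounts (fun _ h => h) hi).antisymm (leastCounts_le_daFinal P m i)

theorem DA_notMem_rejectors (P : Profile n) (m : Fin n) : DA P m ∉ rejectors P m := by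
  intro h
  have hsub : {DA P m} ⊆ proposedSet P m :=
    Set.singleton_subset_iff.2 (proposes_iff.1 (proposes_DA P m)).le
  exact not_beaten_daFinal P (proposes_DA P m) (h.mono hsub fun i _ =>
    (leastCounts_mono P m hsub i).trans (leastCounts_le_daFinal P m i))

/-! ### Misreports of the accomplice -/

section Report

variable (P : Profile n) (m : Fin n) (σ : PrefList n)

theorem report_women : (P.report m σ).women = P.women := rfl

theorem report_men_self : (P.report m σ).men m = σ := by simp [Profile.report]

theorem report_men_of_ne {i : Fin n} (hi : i ≠ m) : (P.report m σ).men i = P.men i := by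
  simp [Profile.report, hi]

theorem report_self : P.report m (P.men m) = P := by
  cases P
  simp [Profile.report]

theorem hasProposed_report : HasProposed (P.report m σ) m = HasProposed P m := by
  funext X k i w
  rcases eq_or_ne i m with rfl | hi
  · simp [HasProposed]
  · simp [HasProposed, hi, report_men_of_ne]

theorem beaten_report : Beaten (P.report m σ) m = Beaten P m := by
  funext X k i w
  rw [Beaten, Beaten, hasProposed_report, report_women]

theorem closedCounts_report : ClosedCounts (P.report m σ) m = ClosedCounts P m := by
  funext X k
  rw [ClosedCounts, ClosedCounts, beaten_report]
  refine propext (forall₂_congr fun i hi => ?_)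
  simp only [Proposes, report_men_of_ne P m σ hi]

theorem leastCounts_report : leastCounts (P.report m σ) m = leastCounts P m := by
  funext X i
  rw [leastCounts, leastCounts, closedCounts_report]

theorem rejectors_report : rejectors (P.report m σ) m = rejectors P m := by
  rw [rejectors, rejectors, beaten_report, leastCounts_report]

end Report

theorem daState_eq_zero_of_notMem_rejectors {P : Profile n} {m y : Fin n}
    (hfirst : (P.men m).pos y = 0) (hy : y ∉ rejectors P m) (r : ℕ) : daState P r m = 0 := by
  induction r with
  | zero => rfl
  | succ r ih =>
    rw [daState_succ, daRound]
    split_ifs with hrej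
    · obtain ⟨w, j, hmw, hjw, hpref⟩ := hrej
      have honly : ∀ v, (P.men m).pos v ≤ daState P r m → v ∈ ({y} : Set (Fin n)) :=
        fun v hv => (P.men m).pos_injective (by omega)
      obtain rfl : w = y := honly w hmw.le
      exact absurd ⟨j, hasProposed_of_proposes (fun _ => rfl)
        (fun _ => daState_le_leastCounts honly) hjw, hpref⟩ hy
    · exact ih

theorem exists_hasProposed_of_pos_eq_zero {P : Profile n} {m y : Fin n}
    (hfirst : (P.men m).pos y = 0) (hy : y ∉ rejectors P m) (w : Fin n) :
    ∃ i, HasProposed P m {y} (leastCounts P m {y}) i w := by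
  have hzero := daState_eq_zero_of_notMem_rejectors hfirst hy (n * n)
  have honly : ∀ v, (P.men m).pos v ≤ daState P (n * n) m → v ∈ ({y} : Set (Fin n)) :=
    fun v hv => (P.men m).pos_injective (by omega)
  obtain ⟨i, rfl⟩ := (DA P).surjective w
  refine ⟨i, hasProposed_of_proposes ?_ (fun _ => daState_le_leastCounts honly) (proposes_DA P i)⟩
  rintro rfl
  exact honly _ (proposes_iff.1 (proposes_DA P i)).le

theorem exists_hasProposed_of_notMem_rejectors {P : Profile n} {m y : Fin n}
    (hy : y ∉ rejectors P m) (w : Fin n) :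
    ∃ i, HasProposed P m {y} (leastCounts P m {y}) i w := by
  have : NeZero n := ⟨m.pos.ne'⟩
  have hfirst : ((P.report m (Equiv.swap 0 y)).men m).pos y = 0 := by
    simp [report_men_self, PrefList.pos]
  have := exists_hasProposed_of_pos_eq_zero hfirst (by rwa [rejectors_report]) w
  rwa [hasProposed_report, leastCounts_report] at this

/- If `y` kept `m`, every woman would have a proposal, so some woman `x` above `DA P m` would keep
`m`. But `x` has rejected him, at a time when the others had fewer rejections. -/
theorem mem_rejectors_of_prefers_DA {P : Profile n} {m y : Fin n}
    (h : (P.men m).Prefers y (DA P m)) : y ∈ rejectors P m := by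
  by_contra hy
  set X : Set (Fin n) := {w | (P.men m).pos w < daFinal P m}
  have hyX : {y} ⊆ X := Set.singleton_subset_iff.2
    ((PrefList.prefers_iff.1 h).trans_eq (proposes_iff.1 (proposes_DA P m)))
  obtain ⟨x, hx, hkept⟩ :=
    exists_not_beaten_of_forall_hasProposed (P := P) (m := m) (X := X) fun w => by
      obtain ⟨i, hi⟩ := exists_hasProposed_of_notMem_rejectors hy w
      exact ⟨i, hi.mono hyX fun j _ => leastCounts_mono P m hyX j⟩
  obtain ⟨r, hr, v, j, hmv, hjv, hpref⟩ := exists_daState_eq_isRejected P m hx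
  obtain rfl : v = x := (P.men m).pos_injective (hmv.trans hr)
  have habove : ∀ w, (P.men m).pos w ≤ daState P r m → w ∈ X :=
    fun w hw => (hw.trans hr.le).trans_lt hx
  exact hkept ⟨j, hasProposed_of_proposes (fun _ => hx)
    (fun _ => daState_le_leastCounts habove) hjv, hpref⟩

theorem noRegret_iff_DA_eq {P : Profile n} {m : Fin n} {σ : PrefList n} :
    NoRegret P m σ ↔ DA (P.report m σ) m = DA P m := by
  refine ⟨fun h => h.resolve_left fun hpref => ?_, Or.inr⟩
  exact DA_notMem_rejectors (P.report m σ) m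
    (by rw [rejectors_report]; exact mem_rejectors_of_prefers_DA hpref)

theorem noRegret_iff_forall_mem_rejectors {P : Profile n} {m : Fin n} {σ : PrefList n} :
    NoRegret P m σ ↔ ∀ w, σ.Prefers w (DA P m) → w ∈ rejectors P m := by
  have habove : ∀ w, σ.Prefers w (DA (P.report m σ) m) → w ∈ rejectors P m := fun w hw => by
    rw [← rejectors_report P m σ]
    exact mem_rejectors_of_prefers_DA (by rwa [report_men_self])
  have hDA : DA (P.report m σ) m ∉ rejectors P m :=
    rejectors_report P m σ ▸ DA_notMem_rejectors (P.report m σ) m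
  rw [noRegret_iff_DA_eq]
  refine ⟨fun h w hw => habove w (h ▸ hw), fun h => ?_⟩
  rcases lt_trichotomy (σ.pos (DA (P.report m σ) m)) (σ.pos (DA P m)) with hlt | heq | hlt
  · exact absurd (h _ hlt) hDA
  · exact σ.pos_injective heq
  · exact absurd (habove _ hlt) (DA_notMem_rejectors P m)

theorem exists_prefList_prefers_iff (X : Set (Fin n)) (a : Fin n) :
    ∃ σ : PrefList n, ∀ w, w ≠ a → (σ.Prefers w a ↔ w ∈ X) := by
  classical
  let f : Fin n → ℕ := fun w => if w = a then 1 else if w ∈ X then 0 else 2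
  have hlt : ∀ u v, f u < f v → (Tuple.sort f).symm u < (Tuple.sort f).symm v := by
    intro u v huv
    by_contra! hle
    have := Tuple.monotone_sort f hle
    simp only [Function.comp_apply, Equiv.apply_symm_apply] at this
    omega
  refine ⟨Tuple.sort f, fun w hw => ?_⟩
  by_cases hX : w ∈ X
  · exact iff_of_true (hlt w a (by simp [f, hw, hX])) hX
  · exact iff_of_false (not_lt.2 (hlt a w (by simp [f, hw, hX])).le) hX

theorem noRegretSet_eq_insert_rejectors (P : Profile n) (m : Fin n) :
    noRegretSet P m = insert (DA P m) (rejectors P m) := by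
  ext w
  rw [Set.mem_insert_iff]
  refine ⟨fun hw => or_iff_not_imp_left.2 fun hne => ?_, fun hw σ hσ => ?_⟩
  · obtain ⟨σ, hσ⟩ :=
      exists_prefList_prefers_iff {v | (P.men m).Prefers v (DA P m) ∨ v = w} (DA P m)
    exact noRegret_iff_forall_mem_rejectors.1 (hw σ hσ) w ((hσ w hne).2 (Or.inr rfl))
  · refine noRegret_iff_forall_mem_rejectors.2 fun v hv => ?_
    have hne : v ≠ DA P m := fun h => lt_irrefl _ (h ▸ hv : σ.Prefers v v)
    rcases (hσ v hne).1 hv with hpref | rfl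
    · exact mem_rejectors_of_prefers_DA hpref
    · exact hw.resolve_left hne

section Optimality

variable {P : Profile n} {m : Fin n} {σ τ : PrefList n}

theorem daFinal_report_mono (h : proposedSet (P.report m τ) m ⊆ proposedSet (P.report m σ) m)
    {i : Fin n} (hi : i ≠ m) : daFinal (P.report m τ) i ≤ daFinal (P.report m σ) i := by
  rw [daFinal_eq_leastCounts _ hi, daFinal_eq_leastCounts _ hi, leastCounts_report,
    leastCounts_report]
  exact leastCounts_mono P m h i

theorem womenWeakPrefer_report (hm : DA (P.report m σ) m = DA (P.report m τ) m)
    (hle : ∀ i, i ≠ m → daFinal (P.report m τ) i ≤ daFinal (P.report m σ) i) :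
    WomenWeakPrefer P (DA (P.report m σ)) (DA (P.report m τ)) := by
  intro w
  obtain ⟨i, rfl⟩ := (DA (P.report m τ)).surjective w
  obtain ⟨j, hj⟩ := (DA (P.report m σ)).surjective (DA (P.report m τ) i)
  rw [Equiv.symm_apply_apply, ← hj, Equiv.symm_apply_apply, hj]
  rcases eq_or_ne i m with rfl | hi
  · exact Or.inr ((DA (P.report i σ)).injective (hj.trans hm.symm))
  have hproposed : ((P.report m σ).men i).pos (DA (P.report m τ) i) ≤ daFinal (P.report m σ) i := by
    have := proposes_iff.1 (proposes_DA (P.report m τ) i)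
    rw [report_men_of_ne P m _ hi] at this ⊢
    exact this.trans_le (hle i hi)
  have hnot := not_prefers_of_proposes_daFinal (P.report m σ) (hj ▸ proposes_DA _ j) hproposed
  exact (not_lt.1 hnot).lt_or_eq.imp_right fun h => (P.women _).symm.injective h

theorem isPushUp_of_prefers_iff (hσ : ∀ w, σ.Prefers w (DA P m) ↔ w ∈ rejectors P m) :
    IsPushUp P m (noRegretSet P m) σ := by
  intro w hw
  rw [hσ, noRegretSet_eq_insert_rejectors, Set.mem_insert_iff, or_iff_right hw]
  exact ⟨Or.inr, fun h => h.elim mem_rejectors_of_prefers_DA id⟩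

theorem womenWeakPrefer_of_prefers_iff (hσ : ∀ w, σ.Prefers w (DA P m) ↔ w ∈ rejectors P m)
    (hτ : NoRegret P m τ) : WomenWeakPrefer P (DA (P.report m σ)) (DA (P.report m τ)) := by
  have eσ : DA (P.report m σ) m = DA P m :=
    noRegret_iff_DA_eq.1 (noRegret_iff_forall_mem_rejectors.2 fun w => (hσ w).1)
  have eτ := noRegret_iff_DA_eq.1 hτ
  refine womenWeakPrefer_report (eσ.trans eτ.symm) fun i => daFinal_report_mono fun w hw => ?_
  rw [mem_proposedSet_iff, report_men_self, eτ] at hw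
  rw [mem_proposedSet_iff, report_men_self, eσ]
  rcases (not_lt.1 hw).lt_or_eq with hlt | heq
  · exact ((hσ w).2 (noRegret_iff_forall_mem_rejectors.1 hτ w hlt)).asymm
  · exact τ.symm.injective heq ▸ lt_irrefl _

theorem isOptimalStrategy_of_prefers_iff (hσ : ∀ w, σ.Prefers w (DA P m) ↔ w ∈ rejectors P m) :
    IsOptimalStrategy P m σ where
  noRegret := noRegret_iff_forall_mem_rejectors.2 fun w => (hσ w).1
  improves := by
    have htruth : NoRegret P m (P.men m) := Or.inr (by rw [report_self])
    simpa only [report_self] using womenWeakPrefer_of_prefers_iff hσ htruth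
  optimal _ hτ := womenWeakPrefer_of_prefers_iff hσ hτ

end Optimality

/-! ### Pushing up -/

open Classical in
/-- The members of `X` in the order of the list `l`, followed by the other agents in that order. -/
noncomputable def pushUpList (l : PrefList n) (X : Set (Fin n)) : List (Fin n) :=
  (List.ofFn l).filter (· ∈ X) ++ (List.ofFn l).filter (· ∉ X)

theorem pushUpList_perm (l : PrefList n) (X : Set (Fin n)) :
    (pushUpList l X).Perm (List.ofFn l) := by
  classical
  simpa only [pushUpList, decide_not] using
    List.filter_append_perm (fun a => decide (a ∈ X)) (List.ofFn l)

theorem length_pushUpList (l : PrefList n) (X : Set (Fin n)) : (pushUpList l X).length = n :=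
  (pushUpList_perm l X).length_eq.trans List.length_ofFn

theorem nodup_pushUpList (l : PrefList n) (X : Set (Fin n)) : (pushUpList l X).Nodup :=
  (pushUpList_perm l X).nodup_iff.2 (List.nodup_ofFn.2 l.injective)

/-- `pushUpList` as a preference list. -/
noncomputable def pushUp (l : PrefList n) (X : Set (Fin n)) : PrefList n :=
  Equiv.ofBijective (fun k => (pushUpList l X).get (k.cast (length_pushUpList l X).symm))
    (Finite.injective_iff_bijective.1
      ((nodup_pushUpList l X).injective_get.comp (Fin.cast_injective _)))

theorem pushUp_apply (l : PrefList n) (X : Set (Fin n)) (k : Fin n) :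
    pushUp l X k = (pushUpList l X)[(k : ℕ)]'(k.is_lt.trans_eq (length_pushUpList l X).symm) :=
  rfl

open Classical in
/-- The number of members of `X`, counted along the list `l`. -/
noncomputable def frontLength (l : PrefList n) (X : Set (Fin n)) : ℕ :=
  ((List.ofFn l).filter (· ∈ X)).length

theorem pushUp_mem_iff (l : PrefList n) (X : Set (Fin n)) (k : Fin n) :
    pushUp l X k ∈ X ↔ (k : ℕ) < frontLength l X := by
  classical
  simp only [pushUp_apply, pushUpList, List.getElem_append]
  split_ifs with hk
  · have hmem := List.getElem_mem hk
    simp only [List.mem_filter, decide_eq_true_eq] at hmem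
    exact iff_of_true hmem.2 hk
  · have hmem := List.getElem_mem (l := (List.ofFn l).filter (· ∉ X))
      (n := k - ((List.ofFn l).filter (· ∈ X)).length) (by
        have := k.is_lt.trans_eq (length_pushUpList l X).symm
        rw [pushUpList, List.length_append] at this
        omega)
    simp only [List.mem_filter, decide_eq_true_eq] at hmem
    exact iff_of_false hmem.2 hk

open Classical in
theorem exists_filter_notMem_eq_cons (l : PrefList n) {X : Set (Fin n)} {a : Fin n} (ha : a ∉ X)
    (habove : ∀ b, l.Prefers b a → b ∈ X) :
    ∃ L, (List.ofFn l).filter (· ∉ X) = a :: L := by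
  have hlt : l.pos a < (List.ofFn l).length := by simpa using l.pos_lt a
  have hget : (List.ofFn l)[l.pos a] = a := by simp [PrefList.pos]
  have hfront : ((List.ofFn l).take (l.pos a)).filter (· ∉ X) = [] := by
    refine List.filter_eq_nil_iff.2 fun b hb => ?_
    obtain ⟨k, hk, rfl⟩ := List.mem_take_iff_getElem.1 hb
    rw [List.getElem_ofFn, decide_eq_true_eq, not_not]
    refine habove _ (PrefList.prefers_iff.2 ?_)
    rw [PrefList.pos_apply]
    exact (lt_min_iff.1 hk).1
  rw [← List.take_append_drop (l.pos a) (List.ofFn l), List.filter_append, hfront,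
    List.drop_eq_getElem_cons hlt, hget, List.filter_cons_of_pos (by simpa using ha)]
  exact ⟨_, rfl⟩

theorem pos_pushUp (l : PrefList n) {X : Set (Fin n)} {a : Fin n} (ha : a ∉ X)
    (habove : ∀ b, l.Prefers b a → b ∈ X) : (pushUp l X).pos a = frontLength l X := by
  classical
  obtain ⟨L, hL⟩ := exists_filter_notMem_eq_cons l ha habove
  have hlist : pushUpList l X = (List.ofFn l).filter (· ∈ X) ++ a :: L := by rw [pushUpList, hL]
  have hlt : frontLength l X < n := by
    have := length_pushUpList l X
    simp only [hlist, List.length_append, List.length_cons] at this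
    unfold frontLength
    omega
  have hget : pushUp l X ⟨frontLength l X, hlt⟩ = a := by
    simp [pushUp_apply, hlist, frontLength]
  simpa only [hget] using (pushUp l X).pos_apply ⟨frontLength l X, hlt⟩

theorem pushUp_prefers_iff (l : PrefList n) {X : Set (Fin n)} {a : Fin n} (ha : a ∉ X)
    (habove : ∀ b, l.Prefers b a → b ∈ X) (b : Fin n) : (pushUp l X).Prefers b a ↔ b ∈ X := by
  obtain ⟨k, rfl⟩ := (pushUp l X).surjective b
  rw [PrefList.prefers_iff, pos_pushUp l ha habove, PrefList.pos_apply, pushUp_mem_iff]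

/-! ### Sequential deferred acceptance -/

/-- The position of man `j` in the list `l`. The label `n` stands for a dummy man, who is liked
less than all the others. -/
def PrefList.rank (l : PrefList n) (j : ℕ) : ℕ := if h : j < n then l.pos ⟨j, h⟩ else n

theorem PrefList.rank_coe (l : PrefList n) (j : Fin n) : l.rank j = l.pos j := dif_pos j.is_lt

theorem PrefList.rank_dummy (l : PrefList n) : l.rank n = n := dif_neg (lt_irrefl n)

theorem PrefList.rank_le (l : PrefList n) (j : ℕ) : l.rank j ≤ n := by
  unfold rank
  split_ifs
  exacts [(l.pos_lt _).le, le_rfl]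

theorem PrefList.exists_coe_eq_of_rank_lt {l : PrefList n} {j : ℕ} (h : l.rank j < n) :
    ∃ i : Fin n, (i : ℕ) = j := by
  by_contra! hj
  exact h.ne (dif_neg fun hlt => hj ⟨j, hlt⟩ rfl)

/-- A configuration of sequential deferred acceptance, where the men enter one after the other:
`ptr j` is the number of rejections of man `j`, `hold x` is the man held by woman `x`, `cand` is
the man who proposes next, and the men from `next` on have not entered yet. The label `n` of a man
stands for nobody. -/
structure Config where
  ptr : ℕ → ℕ
  hold : ℕ → ℕ
  cand : ℕ
  next : ℕ

namespace Config

/-- Woman `x` takes the proposing man, and the man whom she held proposes next. -/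
def swap (g : Config) (x : ℕ) : Config :=
  { g with hold := Function.update g.hold x g.cand, cand := g.hold x }

/-- The proposing man is rejected. -/
def bump (g : Config) : Config :=
  { g with ptr := Function.update g.ptr g.cand (g.ptr g.cand + 1) }

/-- The next man enters and proposes next. -/
def advance (g : Config) : Config := { g with cand := g.next, next := g.next + 1 }

/-- The proposing man proposes to woman `x`, and she rejects one of the two men. -/
def propose (P : Profile n) (g : Config) (x : Fin n) : Config :=
  (if (P.women x).rank g.cand < (P.women x).rank (g.hold x) then g.swap x else g).bump

/-- One step: a proposal, or the entry of the next man if nobody is left to propose. -/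
def step (P : Profile n) (g : Config) : Config :=
  if h : g.cand < n ∧ g.ptr g.cand < n then
    g.propose P (P.men ⟨g.cand, h.1⟩ ⟨g.ptr g.cand, h.2⟩)
  else if g.next < n then g.advance
  else g

/-- All men have entered, and nobody is left to propose. -/
def Done (n : ℕ) (g : Config) : Prop := n ≤ g.next ∧ n ≤ g.ptr g.cand

/-- The configurations that sequential deferred acceptance reaches if woman `w` holds the
accomplice `m` at the start, and `m` does not propose to anybody else: as a proposer he is treated
like a man whom all women have rejected. -/
structure Inv (P : Profile n) (m w : Fin n) (g : Config) : Prop where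
  cand_le : g.cand ≤ n
  next_le : g.next ≤ n
  hold_le : ∀ x : Fin n, g.hold x ≤ n
  le_ptr_self : n ≤ g.ptr m
  le_ptr_dummy : n ≤ g.ptr n
  cand_lt_next : ∀ j : Fin n, j ≠ m → g.cand = j → j < g.next
  of_hold : ∀ x j : Fin n, j ≠ m → g.hold x = j →
    (P.men j).pos x = g.ptr j ∧ g.cand ≠ j ∧ j < g.next
  eq_of_hold_self : ∀ x : Fin n, g.hold x = m → x = w
  engaged : ∀ j : Fin n, j ≠ m → j < g.next → g.ptr j < n → g.cand = j ∨ ∃ x : Fin n, g.hold x = j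
  ptr_le_leastCounts : ∀ j : Fin n, j ≠ m → g.ptr j ≤ leastCounts P m {w} j
  improve : ∀ j x : Fin n, j ≠ m → (P.men j).pos x < g.ptr j →
    (P.women x).rank (g.hold x) < (P.women x).pos j
  improve_self : (P.women w).rank (g.hold w) ≤ (P.women w).pos m

variable {P : Profile n} {m w : Fin n} {g : Config}

theorem inv_of_start (hptr : ∀ j : Fin n, j ≠ m → g.ptr j = 0) (hm : g.ptr m = n)
    (hdummy : g.ptr n = n) (hw : g.hold w = m) (hhold : ∀ x : Fin n, x ≠ w → g.hold x = n)
    (hcand : g.cand = n) (hnext : g.next = 0) : Inv P m w g where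
  cand_le := hcand.le
  next_le := by omega
  hold_le x := by
    rcases eq_or_ne x w with rfl | hx
    · exact hw.trans_le m.is_lt.le
    · exact (hhold x hx).le
  le_ptr_self := hm.ge
  le_ptr_dummy := hdummy.ge
  cand_lt_next j _ h := by omega
  of_hold x j hj h := by
    rcases eq_or_ne x w with rfl | hx
    · exact absurd (Fin.ext (h.symm.trans hw)) hj
    · have := hhold x hx
      omega
  eq_of_hold_self x h := by
    by_contra hx
    have := hhold x hx
    omega
  engaged j _ h := by omega
  ptr_le_leastCounts j hj := (hptr j hj).trans_le (Nat.zero_le _)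
  improve j x hj h := by
    have := hptr j hj
    omega
  improve_self := by rw [hw, PrefList.rank_coe]

namespace Inv

theorem advance (h : Inv P m w g) (hcand : n ≤ g.ptr g.cand) (hnext : g.next < n) :
    Inv P m w g.advance where
  __ := h
  cand_le := hnext.le
  next_le := hnext
  cand_lt_next j _ hj := hj ▸ Nat.lt_succ_self g.next
  of_hold x j hj hx :=
    have ⟨hpos, _, hlt⟩ := h.of_hold x j hj hx
    ⟨hpos, hlt.ne', hlt.trans (Nat.lt_succ_self _)⟩
  engaged j hj hlt hptr := by
    rcases Nat.lt_succ_iff_lt_or_eq.1 hlt with hlt | heq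
    · exact Or.inr ((h.engaged j hj hlt hptr).resolve_left fun e =>
        absurd hcand (not_le.2 (e ▸ hptr)))
    · exact Or.inl heq.symm

theorem swap (h : Inv P m w g) {c x : Fin n} (hc : g.cand = c) (hcm : c ≠ m)
    (hpos : (P.men c).pos x = g.ptr c) (hpref : (P.women x).pos c < (P.women x).rank (g.hold x)) :
    Inv P m w (g.swap x) := by
  have hx : (g.swap x).hold x = c := (Function.update_self ..).trans hc
  have hne : ∀ y : Fin n, y ≠ x → (g.swap x).hold y = g.hold y :=
    fun y hy => Function.update_of_ne (Fin.val_injective.ne hy) ..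
  have hrank : ∀ y, (P.women y).rank ((g.swap x).hold y) ≤ (P.women y).rank (g.hold y) := by
    intro y
    rcases eq_or_ne y x with rfl | hy
    · rw [hx, PrefList.rank_coe]
      exact hpref.le
    · rw [hne y hy]
  refine { h with
    cand_le := h.hold_le x
    hold_le := fun y => ?_
    cand_lt_next := fun j hj e => (h.of_hold x j hj e).2.2
    of_hold := fun y j hj e => ?_
    eq_of_hold_self := fun y e => ?_
    engaged := fun j hj hlt hptr => ?_
    improve := fun j y hj hy => (hrank y).trans_lt (h.improve j y hj hy)
    improve_self := (hrank w).trans h.improve_self }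
  · rcases eq_or_ne y x with rfl | hy
    · exact hx.trans_le c.is_lt.le
    · exact (hne y hy).trans_le (h.hold_le y)
  · rcases eq_or_ne y x with rfl | hy
    · obtain rfl : c = j := Fin.ext (hx.symm.trans e)
      exact ⟨hpos, fun e => (h.of_hold y c hj e).2.1 hc, h.cand_lt_next c hj hc⟩
    · have hy' := h.of_hold y j hj ((hne y hy).symm.trans e)
      exact ⟨hy'.1, fun e => hy ((P.men j).pos_injective
        (hy'.1.trans (h.of_hold x j hj e).1.symm)), hy'.2.2⟩
  · rcases eq_or_ne y x with rfl | hy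
    · exact absurd (Fin.ext (hx.symm.trans e)) hcm
    · exact h.eq_of_hold_self y ((hne y hy).symm.trans e)
  · rcases h.engaged j hj hlt hptr with e | ⟨y, e⟩
    · exact Or.inr ⟨x, hx.trans (hc.symm.trans e)⟩
    · rcases eq_or_ne y x with rfl | hy
      · exact Or.inl e
      · exact Or.inr ⟨y, (hne y hy).trans e⟩

theorem hasProposed_hold (h : Inv P m w g) {x j : Fin n} (hj : g.hold x = j) :
    HasProposed P m {w} (leastCounts P m {w}) j x := by
  by_cases hjm : j = m
  · exact Or.inl ⟨hjm, h.eq_of_hold_self x (hjm ▸ hj)⟩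
  · exact Or.inr ⟨hjm, (h.of_hold x j hjm hj).1.trans_le (h.ptr_le_leastCounts j hjm)⟩

theorem ptr_lt_leastCounts (h : Inv P m w g) {c x : Fin n} (hc : c ≠ m)
    (hpos : (P.men c).pos x = g.ptr c) (hpref : (P.women x).rank (g.hold x) < (P.women x).pos c) :
    g.ptr c < leastCounts P m {w} c := by
  obtain ⟨j, hj⟩ := PrefList.exists_coe_eq_of_rank_lt (hpref.trans ((P.women x).pos_lt c))
  rw [← hj, PrefList.rank_coe] at hpref
  refine (h.ptr_le_leastCounts c hc).lt_of_ne fun heq => ?_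
  exact closedCounts_leastCounts P m {w} c hc x (hpos.trans heq)
    ⟨j, h.hasProposed_hold hj.symm, hpref⟩

theorem bump (h : Inv P m w g) (x : Fin n)
    (hcand : ∀ c : Fin n, c ≠ m → g.cand = c → (P.men c).pos x = g.ptr c ∧
      (P.women x).rank (g.hold x) < (P.women x).pos c) : Inv P m w g.bump := by
  have hself : ∀ c : Fin n, g.cand = c → g.bump.ptr c = g.ptr c + 1 := fun c hc => by
    simp only [Config.bump, hc, Function.update_self]
  have hne : ∀ j, g.cand ≠ j → g.bump.ptr j = g.ptr j := fun j hj =>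
    Function.update_of_ne hj.symm ..
  have hle : ∀ j, g.ptr j ≤ g.bump.ptr j := fun j =>
    le_update_self_iff.2 (Nat.le_succ _) j
  refine { h with
    le_ptr_self := h.le_ptr_self.trans (hle m)
    le_ptr_dummy := h.le_ptr_dummy.trans (hle n)
    of_hold := fun y j hj e => ?_
    engaged := fun j hj hlt hptr => h.engaged j hj hlt ((hle j).trans_lt hptr)
    ptr_le_leastCounts := fun j hj => ?_
    improve := fun j y hj hy => ?_ }
  · obtain ⟨hpos, hcand, hlt⟩ := h.of_hold y j hj e
    exact ⟨hpos.trans (hne j hcand).symm, hcand, hlt⟩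
  · by_cases hc : g.cand = j
    · rw [hself j hc]
      exact h.ptr_lt_leastCounts hj (hcand j hj hc).1 (hcand j hj hc).2
    · exact (hne j hc).trans_le (h.ptr_le_leastCounts j hj)
  · by_cases hc : g.cand = j
    · rw [hself j hc] at hy
      rcases Nat.lt_succ_iff_lt_or_eq.1 hy with hy | hy
      · exact h.improve j y hj hy
      · obtain rfl : y = x := (P.men j).pos_injective (hy.trans (hcand j hj hc).1.symm)
        exact (hcand j hj hc).2
    · exact h.improve j y hj (hy.trans_eq (hne j hc))

theorem ne_of_ptr_lt (h : Inv P m w g) {c : Fin n} (hc : g.ptr c < n) : c ≠ m := by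
  rintro rfl
  exact absurd h.le_ptr_self (not_le.2 hc)

theorem propose (h : Inv P m w g) {c x : Fin n} (hc : g.cand = c) (hcm : c ≠ m)
    (hpos : (P.men c).pos x = g.ptr c) : Inv P m w (g.propose P x) := by
  rw [Config.propose, hc, PrefList.rank_coe]
  split_ifs with hpref
  · refine (h.swap hc hcm hpos hpref).bump x fun d hd hhold => ?_
    have hx : (g.swap x).hold x = c := (Function.update_self ..).trans hc
    refine ⟨(h.of_hold x d hd hhold).1, ?_⟩
    rwa [hx, PrefList.rank_coe, ← PrefList.rank_coe _ d, ← show g.hold x = d from hhold]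
  · refine h.bump x fun d _ hd => ?_
    obtain rfl : c = d := Fin.ext (hc.symm.trans hd)
    refine ⟨hpos, (not_lt.1 hpref).lt_of_ne fun heq => ?_⟩
    obtain ⟨j, hj⟩ := PrefList.exists_coe_eq_of_rank_lt (heq.trans_lt ((P.women x).pos_lt c))
    rw [← hj, PrefList.rank_coe] at heq
    obtain rfl := (P.women x).pos_injective heq
    exact (h.of_hold x j hcm hj.symm).2.1 hc

theorem step (h : Inv P m w g) : Inv P m w (g.step P) := by
  unfold Config.step
  split_ifs with hcand hnext
  · exact h.propose (c := ⟨g.cand, hcand.1⟩) rfl (h.ne_of_ptr_lt hcand.2) (PrefList.pos_apply ..)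
  · refine h.advance ?_ hnext
    rcases h.cand_le.lt_or_eq with hlt | heq
    · exact not_lt.1 fun hptr => hcand ⟨hlt, hptr⟩
    · exact heq ▸ h.le_ptr_dummy
  · exact h

theorem hold_eq_of_done (h : Inv P m w g) (hdone : g.Done n) {j x : Fin n} (hj : j ≠ m)
    (hpos : (P.men j).pos x = g.ptr j) : g.hold x = j := by
  have hptr : g.ptr j < n := hpos ▸ (P.men j).pos_lt x
  rcases h.engaged j hj (j.is_lt.trans_le hdone.1) hptr with hcand | ⟨y, hy⟩
  · exact absurd hdone.2 (not_le.2 (hcand ▸ hptr))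
  · rwa [(P.men j).pos_injective (hpos.trans (h.of_hold y j hj hy).1.symm)]

theorem rank_hold_le_of_done (h : Inv P m w g) (hdone : g.Done n) {j x : Fin n}
    (hj : HasProposed P m {w} (fun i => g.ptr i) j x) :
    (P.women x).rank (g.hold x) ≤ (P.women x).pos j := by
  rcases hj with ⟨rfl, rfl⟩ | ⟨hjm, hle⟩
  · exact h.improve_self
  · rcases hle.lt_or_eq with hlt | heq
    · exact (h.improve j x hjm hlt).le
    · rw [h.hold_eq_of_done hdone hjm heq, PrefList.rank_coe]

theorem closedCounts_of_done (h : Inv P m w g) (hdone : g.Done n) :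
    ClosedCounts P m {w} fun i => g.ptr i := by
  rintro i hi x hx ⟨j, hj, hpref⟩
  have := h.rank_hold_le_of_done hdone hj
  rw [h.hold_eq_of_done hdone hi hx, PrefList.rank_coe] at this
  exact absurd hpref (not_lt.2 this)

theorem hold_ne_iff_of_done (h : Inv P m w g) (hdone : g.Done n) :
    g.hold w ≠ m ↔ w ∈ rejectors P m := by
  constructor
  · intro hne
    have hle := h.improve_self
    obtain ⟨j, hj⟩ := PrefList.exists_coe_eq_of_rank_lt (hle.trans_lt ((P.women w).pos_lt m))
    rw [← hj, PrefList.rank_coe] at hle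
    refine ⟨j, h.hasProposed_hold hj.symm, hle.lt_of_ne fun heq => hne ?_⟩
    rw [← hj, (P.women w).pos_injective heq]
  · rintro ⟨j, hj, hpref⟩ hm
    have hptr : ∀ i, i ≠ m → leastCounts P m {w} i ≤ g.ptr i :=
      fun i _ => leastCounts_le (h.closedCounts_of_done hdone) i
    have := h.rank_hold_le_of_done hdone (hj.mono subset_rfl hptr)
    rw [hm, PrefList.rank_coe] at this
    exact absurd hpref (not_lt.2 this)

end Inv

/-- A quantity that grows in every step until sequential deferred acceptance is done. A proposal
rejects a man other than `m` or else leaves no such man to propose, hence the last summand. -/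
def potential (m : Fin n) (g : Config) : ℕ :=
  2 * ∑ j ∈ Finset.univ.erase m, g.ptr j + 2 * g.next + if g.cand = m ∨ g.cand = n then 1 else 0

theorem sum_ptr_le_bump (g : Config) (m : Fin n) :
    ∑ j ∈ Finset.univ.erase m, g.ptr j ≤ ∑ j ∈ Finset.univ.erase m, g.bump.ptr j :=
  Finset.sum_le_sum fun j _ => le_update_self_iff.2 (Nat.le_succ _) (j : ℕ)

theorem sum_ptr_lt_bump {c : Fin n} (hc : g.cand = c) (hcm : c ≠ m) :
    ∑ j ∈ Finset.univ.erase m, g.ptr j < ∑ j ∈ Finset.univ.erase m, g.bump.ptr j :=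
  Finset.sum_lt_sum (fun j _ => le_update_self_iff.2 (Nat.le_succ _) (j : ℕ))
    ⟨c, by simpa using hcm, by simp [bump, hc]⟩

theorem Inv.potential_lt_propose (h : Inv P m w g) {c : Fin n} (hc : g.cand = c) (hcm : c ≠ m)
    (x : Fin n) : g.potential m < (g.propose P x).potential m := by
  have hactive : ∀ d : Fin n, d ≠ m → ¬ ((d : ℕ) = m ∨ (d : ℕ) = n) := fun d hd => by omega
  rw [Config.propose]
  split_ifs
  · by_cases hx : g.hold x = m ∨ g.hold x = n
    · have hsum := (g.swap x).sum_ptr_le_bump m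
      simp only [potential, Config.bump, Config.swap, hx, hc, hactive c hcm, if_true, if_false]
        at hsum ⊢
      omega
    · have hlt : g.hold x < n := by have := h.hold_le x; omega
      have hsum := sum_ptr_lt_bump (g := g.swap x) (m := m) (c := ⟨g.hold x, hlt⟩) rfl
        (fun e => hx (Or.inl (congrArg Fin.val e)))
      simp only [potential, Config.bump, Config.swap, hx, hc, hactive c hcm, if_false] at hsum ⊢
      omega
  · have hsum := sum_ptr_lt_bump hc hcm
    simp only [potential, Config.bump, hc, hactive c hcm, if_false] at hsum ⊢
    omega

theorem Inv.potential_lt_step (h : Inv P m w g) (hdone : ¬ g.Done n) :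
    g.potential m < (g.step P).potential m := by
  unfold Config.step
  split_ifs with hcand hnext
  · exact h.potential_lt_propose (c := ⟨g.cand, hcand.1⟩) rfl (h.ne_of_ptr_lt hcand.2) _
  · simp only [potential, Config.advance]
    split_ifs <;> omega
  · refine absurd ⟨not_lt.1 hnext, not_lt.1 fun hptr => hcand ⟨?_, hptr⟩⟩ hdone
    exact h.cand_le.lt_of_ne fun e => absurd h.le_ptr_dummy (not_le.2 (e ▸ hptr))

theorem Inv.potential_lt (h : Inv P m w g) : g.potential m < 6 * n * n := by
  have hptr : ∀ j ∈ Finset.univ.erase m, g.ptr j ≤ n := fun j hj =>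
    (h.ptr_le_leastCounts j (Finset.ne_of_mem_erase hj)).trans (leastCounts_le_card P m _ j)
  have hsum := Finset.sum_le_card_nsmul _ _ n hptr
  rw [Finset.card_erase_of_mem (Finset.mem_univ m), Finset.card_univ, Fintype.card_fin,
    smul_eq_mul] at hsum
  have hmul : (n - 1) * n ≤ n * n := Nat.mul_le_mul_right n n.pred_le
  have hn : n ≤ n * n := Nat.le_mul_self n
  have := m.pos
  have := h.next_le
  rw [potential, mul_assoc]
  split_ifs <;> omega

theorem Done.step_eq (h : g.Done n) : g.step P = g := by
  have hnext := h.1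
  have hptr := h.2
  rw [Config.step, dif_neg (by omega), if_neg (by omega)]

/-- The configurations that are reached after `k` steps. -/
structure RunInv (P : Profile n) (m w : Fin n) (k : ℕ) (g : Config) : Prop where
  inv : Inv P m w g
  ptr_le : ∀ j ≤ n, g.ptr j ≤ n + k
  progress : g.Done n ∨ k ≤ g.potential m

theorem runInv_start {ptr hold : ℕ → ℕ} (hptr : ∀ j < n, ptr j = 0) (hhold : ∀ x < n, hold x = n) :
    RunInv P m w 0
      ⟨Function.update (Function.update ptr m n) n n, Function.update hold w m, n, 0⟩ where
  inv := inv_of_start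
    (fun j hj => by simp [j.is_lt.ne, Fin.val_injective.ne hj, hptr])
    (by simp [Function.update_apply]) (by simp) (by simp)
    (fun x hx => by simp [Fin.val_injective.ne hx, hhold]) rfl rfl
  ptr_le j hj := by
    simp only [Function.update_apply]
    split_ifs with h
    exacts [le_rfl, le_rfl, (hptr j (by omega)).trans_le n.zero_le]
  progress := Or.inr (Nat.zero_le _)

theorem ptr_bump_le (g : Config) (j : ℕ) : g.bump.ptr j ≤ g.ptr j + 1 := by
  rcases eq_or_ne j g.cand with rfl | hj <;> simp [bump, *]

theorem ptr_step_le (P : Profile n) (g : Config) (j : ℕ) : (g.step P).ptr j ≤ g.ptr j + 1 := by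
  unfold step propose
  split_ifs
  exacts [(g.swap _).ptr_bump_le j, g.ptr_bump_le j, Nat.le_succ _, Nat.le_succ _]

theorem RunInv.step {k : ℕ} (h : RunInv P m w k g) : RunInv P m w (k + 1) (g.step P) where
  inv := h.inv.step
  ptr_le j hj := by
    have := h.ptr_le j hj
    have := ptr_step_le P g j
    omega
  progress := by
    by_cases hdone : g.Done n
    · rw [hdone.step_eq]
      exact Or.inl hdone
    · exact Or.inr ((h.progress.resolve_left hdone).trans_lt (h.inv.potential_lt_step hdone))

theorem RunInv.hold_ne_iff (h : RunInv P m w (6 * n * n) g) :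
    g.hold w ≠ m ↔ w ∈ rejectors P m :=
  h.inv.hold_ne_iff_of_done (h.progress.resolve_right (not_le.2 h.inv.potential_lt))

end Config

/-! ### Running programs -/

theorem State.reg_setReg (s : State) (x v y : ℕ) :
    (s.setReg x v).reg y = if y = x then v else s.reg y := Function.update_apply ..

theorem State.arr_setReg (s : State) (x v : ℕ) : (s.setReg x v).arr = s.arr := rfl

theorem State.reg_setArr (s : State) (a i v : ℕ) : (s.setArr a i v).reg = s.reg := rfl

theorem State.arr_setArr (s : State) (a i v b j : ℕ) :
    (s.setArr a i v).arr b j = if b = a ∧ j = i then v else s.arr b j := by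
  by_cases hb : b = a
  · subst hb
    simp [setArr, Function.update_apply]
  · simp [setArr, hb]

/-- The program `p`, started in state `s`, halts without overflow, and its final state and its
number of steps satisfy `Q`: a weakest precondition that also counts steps. -/
def RunsIn (B : ℕ) (p : Prog) (s : State) (Q : State → ℕ → Prop) : Prop :=
  ∃ s' t, Exec B p s s' t ∧ Q s' t

section Rules

variable {B : ℕ} {p q : Prog} {s : State} {Q R : State → ℕ → Prop}

theorem RunsIn.mono (h : RunsIn B p s Q) (hQR : ∀ s' t, Q s' t → R s' t) : RunsIn B p s R :=
  let ⟨s', t, hexec, hQ⟩ := h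
  ⟨s', t, hexec, hQR s' t hQ⟩

theorem runsIn_skip : RunsIn B .skip s Q ↔ Q s 1 := by
  constructor
  · rintro ⟨_, _, ⟨⟩, h⟩
    exact h
  · exact fun h => ⟨_, _, .skip s, h⟩

theorem runsIn_assign {x : ℕ} {e : Expr} :
    RunsIn B (.assign x e) s Q ↔ e.Fits B s ∧ Q (s.setReg x (e.eval s)) (e.cost + 1) := by
  constructor
  · rintro ⟨_, _, ⟨⟩, h⟩
    exact ⟨‹_›, h⟩
  · exact fun ⟨he, h⟩ => ⟨_, _, .assign s x e he, h⟩

theorem runsIn_write {a : ℕ} {i e : Expr} :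
    RunsIn B (.write a i e) s Q ↔ i.Fits B s ∧ e.Fits B s ∧
      Q (s.setArr a (i.eval s) (e.eval s)) (i.cost + e.cost + 1) := by
  constructor
  · rintro ⟨_, _, ⟨⟩, h⟩
    exact ⟨‹_›, ‹_›, h⟩
  · exact fun ⟨hi, he, h⟩ => ⟨_, _, .write s a i e hi he, h⟩

theorem runsIn_seq : RunsIn B (.seq p q) s Q ↔
    RunsIn B p s fun s₁ t₁ => RunsIn B q s₁ fun s₂ t₂ => Q s₂ (t₁ + t₂) := by
  constructor
  · rintro ⟨_, _, hexec, h⟩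
    cases hexec with
    | seq h₁ h₂ => exact ⟨_, _, h₁, _, _, h₂, h⟩
  · exact fun ⟨_, _, h₁, _, _, h₂, h⟩ => ⟨_, _, .seq h₁ h₂, h⟩

theorem runsIn_cond {e : Expr} : RunsIn B (.cond e p q) s Q ↔ e.Fits B s ∧
    if e.eval s ≠ 0 then RunsIn B p s fun s' t => Q s' (e.cost + 1 + t)
    else RunsIn B q s fun s' t => Q s' (e.cost + 1 + t) := by
  constructor
  · rintro ⟨_, _, hexec, h⟩
    cases hexec with
    | condTrue hf he h₁ => exact ⟨hf, by rw [if_pos he]; exact ⟨_, _, h₁, h⟩⟩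
    | condFalse hf he h₁ => exact ⟨hf, by rw [if_neg (not_not.2 he)]; exact ⟨_, _, h₁, h⟩⟩
  · rintro ⟨hf, h⟩
    split_ifs at h with he <;> obtain ⟨_, _, h₁, h⟩ := h
    · exact ⟨_, _, .condTrue hf he h₁, h⟩
    · exact ⟨_, _, .condFalse hf (not_not.1 he) h₁, h⟩

theorem RunsIn.loop {e : Expr} {J : ℕ → State → Prop} {N T : ℕ}
    (htest : ∀ k ≤ N, ∀ s, J k s → e.Fits B s ∧ (e.eval s ≠ 0 ↔ k < N))
    (hbody : ∀ k < N, ∀ s, J k s → RunsIn B p s fun s' t => t ≤ T ∧ J (k + 1) s')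
    {k : ℕ} (hk : k ≤ N) (hs : J k s) :
    RunsIn B (.loop e p) s fun s' t => t ≤ (N - k) * (e.cost + 1 + T) + e.cost + 1 ∧ J N s' := by
  induction hd : N - k generalizing k s with
  | zero =>
    obtain rfl : k = N := by omega
    obtain ⟨hf, he⟩ := htest k le_rfl s hs
    exact ⟨_, _, .loopFalse hf (by simpa using he), by omega, hs⟩
  | succ d ih =>
    obtain ⟨hf, he⟩ := htest k hk s hs
    obtain ⟨s₁, t₁, h₁, ht₁, hs₁⟩ := hbody k (by omega) s hs
    obtain ⟨s₂, t₂, h₂, ht₂, hs₂⟩ := ih (k := k + 1) (by omega) hs₁ (by omega)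
    refine ⟨s₂, _, .loopTrue hf (he.2 (by omega)) h₁ h₂, ?_, hs₂⟩
    rw [Nat.succ_mul]
    omega

end Rules

namespace Prog

/-- The registers to which a program assigns. -/
def regs : Prog → List ℕ
  | skip | write .. => []
  | assign x _ => [x]
  | seq p q | cond _ p q => p.regs ++ q.regs
  | loop _ p => p.regs

/-- The arrays to which a program writes. -/
def arrs : Prog → List ℕ
  | skip | assign .. => []
  | write a .. => [a]
  | seq p q | cond _ p q => p.arrs ++ q.arrs
  | loop _ p => p.arrs

/-- The states `s` and `s'` agree outside the registers and arrays that `p` may change. -/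
structure Frame (p : Prog) (s s' : State) : Prop where
  reg_eq : ∀ x ∉ p.regs, s'.reg x = s.reg x
  arr_eq : ∀ a ∉ p.arrs, s'.arr a = s.arr a

variable {p q : Prog} {s s₁ s₂ : State}

theorem Frame.refl (p : Prog) (s : State) : p.Frame s s := ⟨fun _ _ => rfl, fun _ _ => rfl⟩

theorem Frame.trans (h₁ : p.Frame s s₁) (h₂ : p.Frame s₁ s₂) : p.Frame s s₂ where
  reg_eq x hx := (h₂.reg_eq x hx).trans (h₁.reg_eq x hx)
  arr_eq a ha := (h₂.arr_eq a ha).trans (h₁.arr_eq a ha)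

theorem Frame.mono (h : p.Frame s s₁) (hregs : p.regs ⊆ q.regs) (harrs : p.arrs ⊆ q.arrs) :
    q.Frame s s₁ where
  reg_eq x hx := h.reg_eq x fun hp => hx (hregs hp)
  arr_eq a ha := h.arr_eq a fun hp => ha (harrs hp)

theorem Frame.setReg {x : ℕ} (hx : x ∈ p.regs) (v : ℕ) : p.Frame s (s.setReg x v) where
  reg_eq y hy := by rw [State.reg_setReg, if_neg (ne_of_mem_of_not_mem hx hy).symm]
  arr_eq _ _ := rfl

theorem Frame.setArr {a : ℕ} (ha : a ∈ p.arrs) (i v : ℕ) : p.Frame s (s.setArr a i v) where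
  reg_eq _ _ := rfl
  arr_eq b hb := funext fun j => by
    rw [State.arr_setArr, if_neg fun e => ne_of_mem_of_not_mem ha hb e.1.symm]

/-- Run the programs of a list one after the other. -/
def block (ps : List Prog) : Prog := ps.foldr seq skip

/-- Run `p` with register `x` counting from `0` up to, but not including, register `y`. -/
def forLoop (x y : ℕ) (p : Prog) : Prog :=
  .seq (.assign x (.lit 0)) <| .loop (.bin .lt (.reg x) (.reg y)) <|
    .seq p (.assign x (.bin .add (.reg x) (.lit 1)))

end Prog

theorem Exec.frame {B t : ℕ} {p : Prog} {s s' : State} (h : Exec B p s s' t) : p.Frame s s' := by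
  induction h with
  | skip s => exact .refl ..
  | assign s x e => exact .setReg (List.mem_singleton_self x) _
  | write s a i e => exact .setArr (List.mem_singleton_self a) ..
  | seq _ _ ih₁ ih₂ =>
    exact (ih₁.mono (List.subset_append_left ..) (List.subset_append_left ..)).trans
      (ih₂.mono (List.subset_append_right ..) (List.subset_append_right ..))
  | condTrue _ _ _ ih => exact ih.mono (List.subset_append_left ..) (List.subset_append_left ..)
  | condFalse _ _ _ ih => exact ih.mono (List.subset_append_right ..) (List.subset_append_right ..)
  | loopTrue _ _ _ _ ih₁ ih₂ =>
    exact .trans (ih₁.mono (List.Subset.refl _) (List.Subset.refl _)) ih₂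
  | loopFalse => exact .refl ..

theorem RunsIn.frame {B : ℕ} {p : Prog} {s : State} {Q : State → ℕ → Prop} (h : RunsIn B p s Q) :
    RunsIn B p s fun s' t => p.Frame s s' ∧ Q s' t :=
  let ⟨s', t, hexec, hQ⟩ := h
  ⟨s', t, hexec, hexec.frame, hQ⟩

theorem RunsIn.forLoop {B x y N T : ℕ} {p : Prog} {s : State} {I : ℕ → State → Prop}
    (hxy : x ≠ y) (hx : x ∉ p.regs) (hy : y ∉ p.regs) (hN : s.reg y = N) (hB : N ≤ B)
    (hI : ∀ k s v, I k s → I k (s.setReg x v)) (hzero : I 0 s)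
    (hbody : ∀ k s', k < N → s'.reg x = k → (Prog.forLoop x y p).Frame s s' → I k s' →
      RunsIn B p s' fun s'' t => t ≤ T ∧ I (k + 1) s'') :
    RunsIn B (.forLoop x y p) s fun s' t => t ≤ N * (T + 8) + 6 ∧ I N s' := by
  have hframe_y {s'} (h : (Prog.forLoop x y p).Frame s s') : s'.reg y = N :=
    (h.reg_eq y (by simp [Prog.forLoop, Prog.regs, hxy.symm, hy])).trans hN
  have hxmem : x ∈ (Prog.forLoop x y p).regs := List.mem_cons_self
  refine runsIn_seq.2 (runsIn_assign.2 ⟨Nat.zero_le B, ?_⟩)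
  refine (RunsIn.loop (N := N) (T := T + 4) (k := 0)
    (J := fun k s' => s'.reg x = k ∧ (Prog.forLoop x y p).Frame s s' ∧ I k s')
    (fun k hk s' ⟨hk', hs', _⟩ => ?_) (fun k hk s' ⟨hk', hs', hIk⟩ => ?_) (Nat.zero_le _)
    ⟨by simp [State.reg_setReg, Expr.eval], ?_, hI 0 s _ hzero⟩).mono fun s' t ⟨ht, _, _, hs'⟩ => ?_
  · simp only [Expr.Fits, Expr.eval, Op.eval, hk', hframe_y hs']
    split_ifs <;> omega
  · refine runsIn_seq.2 ((hbody k s' hk hk' hs' hIk).frame.mono fun s₁ t ⟨hs₁, ht, hIk₁⟩ => ?_)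
    have hx₁ : s₁.reg x = k := (hs₁.reg_eq x hx).trans hk'
    refine runsIn_assign.2 ⟨by simp only [Expr.Fits, Expr.eval, Op.eval]; omega, ?_, ?_, ?_, ?_⟩
    · exact Nat.add_le_add_right ht 4
    · simp only [State.reg_setReg, Expr.eval, Op.eval, hx₁, if_true]
    · exact (hs'.trans (hs₁.mono (by simp [Prog.forLoop, Prog.regs])
        (by simp [Prog.forLoop, Prog.arrs]))).trans (.setReg hxmem _)
    · exact hI _ _ _ hIk₁
  · exact .setReg hxmem _
  · refine ⟨?_, hs'⟩
    calc _ ≤ 2 + ((N - 0) * (4 + (T + 4)) + 4) := Nat.add_le_add_left ht 2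
      _ = N * (T + 8) + 6 := by rw [Nat.sub_zero]; ring

/-! ### Input and tables -/

theorem mul_add_inj_of_lt {a b u v : ℕ} (hu : u < n) (hv : v < n) :
    a * n + u = b * n + v ↔ a = b ∧ u = v := by
  refine ⟨fun h => ?_, by rintro ⟨rfl, rfl⟩; rfl⟩
  have hdiv := congrArg (· / n) h
  have hn : 0 < n := by omega
  simp only [mul_comm _ n, Nat.mul_add_div hn, Nat.div_eq_of_lt hu,
    Nat.div_eq_of_lt hv, add_zero] at hdiv
  subst hdiv
  exact ⟨rfl, by omega⟩

theorem State.arr_setArr_table (s : State) (a i x j : ℕ) {u v : ℕ} (hu : u < n) (hv : v < n) :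
    (s.setArr a (i * n + v) x).arr a (j * n + u) =
      if j = i ∧ u = v then x else s.arr a (j * n + u) := by
  simp only [arr_setArr, mul_add_inj_of_lt hu hv, true_and]

theorem table_apply (T : Fin n → PrefList n) (i k : Fin n) : table T (i * n + k) = T i k := by
  have hlt : (i * n + k : ℕ) < n * n := by
    have := Nat.mul_le_mul_right n (Nat.succ_le_of_lt i.is_lt)
    rw [Nat.succ_mul] at this
    omega
  have hdiv : Fin.divNat (⟨i * n + k, hlt⟩ : Fin (n * n)) = i :=
    Fin.ext (by simp [Nat.add_div_of_dvd_right, Nat.div_eq_of_lt, i.pos])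
  have hmod : Fin.modNat (⟨i * n + k, hlt⟩ : Fin (n * n)) = k :=
    Fin.ext (by simp [Nat.mod_eq_of_lt])
  rw [table, dif_pos hlt, hdiv, hmod]

/-- The input of the algorithm is still in its place. -/
structure HoldsInput (P : Profile n) (m : Fin n) (s : State) : Prop where
  reg_zero : s.reg 0 = n
  reg_one : s.reg 1 = m
  men : s.arr 0 = table P.men
  women : s.arr 1 = table P.women

theorem holdsInput_inputState (P : Profile n) (m : Fin n) : HoldsInput P m (inputState P m) :=
  ⟨rfl, rfl, rfl, rfl⟩

/-- The program `p` does not change the input. -/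
abbrev Prog.KeepsInput (p : Prog) : Prop :=
  0 ∉ p.regs ∧ 1 ∉ p.regs ∧ 0 ∉ p.arrs ∧ 1 ∉ p.arrs

namespace HoldsInput

variable {P : Profile n} {m : Fin n} {s s' : State}

theorem of_frame (h : HoldsInput P m s) {p : Prog} (hp : p.KeepsInput) (hs : p.Frame s s') :
    HoldsInput P m s' where
  reg_zero := (hs.reg_eq 0 hp.1).trans h.reg_zero
  reg_one := (hs.reg_eq 1 hp.2.1).trans h.reg_one
  men := (hs.arr_eq 0 hp.2.2.1).trans h.men
  women := (hs.arr_eq 1 hp.2.2.2).trans h.women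

theorem men_apply (h : HoldsInput P m s) (i k : Fin n) : s.arr 0 (i * n + k) = P.men i k := by
  rw [h.men, table_apply]

theorem women_apply (h : HoldsInput P m s) (v k : Fin n) : s.arr 1 (v * n + k) = P.women v k := by
  rw [h.women, table_apply]

end HoldsInput

namespace Expr

/-- The address of the entry in row `i` and column `j` of a table with `n` columns. -/
def index (i j : Expr) : Expr := .bin .add (.bin .mul i (.reg 0)) j

/-- The entry in row `i` and column `j` of the table in array `a`. -/
def entry (a : ℕ) (i j : Expr) : Expr := .read a (index i j)

variable {s : State} {i j : Expr}

theorem eval_index (hs : s.reg 0 = n) : (index i j).eval s = i.eval s * n + j.eval s := by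
  rw [← hs]
  rfl

theorem eval_entry {a : ℕ} (hs : s.reg 0 = n) :
    (entry a i j).eval s = s.arr a (i.eval s * n + j.eval s) := by
  rw [← eval_index hs]
  rfl

variable {B : ℕ}

theorem Fits.index (hB : 20 * (n * n) ≤ B) (hs : s.reg 0 = n) (hi : i.Fits B s)
    (hi' : i.eval s ≤ n) (hj : j.Fits B s) (hj' : j.eval s < n) : (index i j).Fits B s := by
  have hmul := Nat.mul_le_mul_right n hi'
  have hn := Nat.le_mul_self n
  simp only [Expr.index, Fits, eval, Op.eval, hs]
  exact ⟨⟨hi, by omega, by omega⟩, hj, by omega⟩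

theorem Fits.entry {a : ℕ} (hB : 20 * (n * n) ≤ B) (hs : s.reg 0 = n) (hi : i.Fits B s)
    (hi' : i.eval s ≤ n) (hj : j.Fits B s) (hj' : j.eval s < n)
    (ha : s.arr a (i.eval s * n + j.eval s) ≤ B) : (entry a i j).Fits B s :=
  ⟨.index hB hs hi hi' hj hj', by rwa [eval_index hs]⟩

end Expr

/-! ### The program

Register `0` holds `n` and register `1` the accomplice. -/

/-- Stores in column `v` of the table in array `4`, where `v` is the woman in register `2`, the
positions of the men in her list. -/
def rankColumnProg : Prog :=
  .forLoop 3 0 <| .write 4 (.index (.entry 1 (.reg 2) (.reg 3)) (.reg 2)) (.reg 3)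

/-- Stores in row `j` and column `v` of the table in array `4` the position of man `j` in the list
of woman `v`, where row `n` stands for the dummy man. -/
def rankProg : Prog :=
  .forLoop 2 0 <| .block [rankColumnProg, .write 4 (.index (.reg 0) (.reg 2)) (.reg 0)]

/-- Sets up sequential deferred acceptance, where woman `w` in register `2` holds the accomplice
and is the only woman to whom he proposes. Array `5` holds `ptr`, array `6` holds `hold`,
register `4` holds `cand`, and register `5` holds `next`. -/
def startProg : Prog := .block [
  .forLoop 3 0 <| .block [.write 5 (.reg 3) (.lit 0), .write 6 (.reg 3) (.reg 0)],
  .write 5 (.reg 1) (.reg 0),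
  .write 5 (.reg 0) (.reg 0),
  .write 6 (.reg 2) (.reg 1),
  .assign 4 (.reg 0),
  .assign 5 (.lit 0)]

/-- The woman in register `6` takes the proposing man. -/
def swapProg : Prog := .block [
  .assign 7 (.read 6 (.reg 6)),
  .write 6 (.reg 6) (.reg 4),
  .assign 4 (.reg 7)]

/-- The proposing man is rejected. -/
def bumpProg : Prog := .write 5 (.reg 4) (.bin .add (.read 5 (.reg 4)) (.lit 1))

/-- The next man enters. -/
def advanceProg : Prog := .block [
  .assign 4 (.reg 5),
  .assign 5 (.bin .add (.reg 5) (.lit 1))]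

/-- The woman in register `6` takes the proposing man if she prefers him to the man she holds. -/
def compareProg : Prog :=
  .cond (.bin .lt (.entry 4 (.reg 4) (.reg 6)) (.entry 4 (.read 6 (.reg 6)) (.reg 6)))
    swapProg .skip

/-- The proposing man proposes to the next woman of his list. -/
def proposeProg : Prog := .block [
  .assign 6 (.entry 0 (.reg 4) (.read 5 (.reg 4))),
  compareProg,
  bumpProg]

/-- One step of sequential deferred acceptance. -/
def stepProg : Prog :=
  .cond (.bin .lt (.read 5 (.reg 4)) (.reg 0)) proposeProg <|
    .cond (.bin .lt (.reg 5) (.reg 0)) advanceProg .skip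

/-- Tests whether the woman in register `2` rejects the accomplice when he proposes to nobody
else. Register `8` holds the number of steps of sequential deferred acceptance. -/
def testProg : Prog := .block [
  startProg,
  .forLoop 3 8 stepProg,
  .write 3 (.reg 2) (.bin .sub (.lit 1) (.bin .eq (.read 6 (.reg 2)) (.reg 1)))]

/-- Stores in array `3` the indicator function of `rejectors`. -/
def rejectProg : Prog := .block [
  .assign 8 (.bin .mul (.bin .mul (.lit 6) (.reg 0)) (.reg 0)),
  .forLoop 2 0 testProg]

/-- Appends the woman in register `5` to the list in array `2`, whose length is in register `4`. -/
def appendProg : Prog := .block [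
  .write 2 (.reg 4) (.reg 5),
  .assign 4 (.bin .add (.reg 4) (.lit 1))]

/-- Appends the woman in position `k` of the accomplice's list, where `k` is in register `3`, to the
list in array `2` if array `3` holds `b` at her. -/
def collectStepProg (b : ℕ) : Prog := .block [
  .assign 5 (.entry 0 (.reg 1) (.reg 3)),
  .cond (.bin .eq (.read 3 (.reg 5)) (.lit b)) appendProg .skip]

/-- Appends to the list in array `2` the women of the accomplice's list at whom array `3` holds
`b`, in the order of his list. -/
def collectProg (b : ℕ) : Prog := .forLoop 3 0 (collectStepProg b)

/-- Outputs the accomplice's list with the women of the set in array `3` moved to the front, and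
stores their number in register `6`. -/
def pushUpProg : Prog := .block [
  .assign 4 (.lit 0),
  collectProg 1,
  .assign 6 (.reg 4),
  collectProg 0]

/-- Adds to the set in array `3` the true partner of the accomplice, who is the first woman behind
those moved to the front. -/
def addPartnerProg : Prog := .write 3 (.read 2 (.reg 6)) (.lit 1)

/-- Outputs the no-regret set and an optimal one-for-all strategy of the accomplice. -/
def oneForAllProg : Prog := .block [rankProg, rejectProg, pushUpProg, addPartnerProg]

/-- The columns of the women `v < k` in array `4` hold the ranks of all men. -/
def HasRanksBelow (P : Profile n) (k : ℕ) (s : State) : Prop :=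
  ∀ v : Fin n, v < k → ∀ j ≤ n, s.arr 4 (j * n + v) = (P.women v).rank j

theorem HasRanksBelow.of_frame {P : Profile n} {k : ℕ} {s s' : State} (h : HasRanksBelow P k s)
    {p : Prog} (hp : 4 ∉ p.arrs) (hs : p.Frame s s') : HasRanksBelow P k s' := by
  rwa [HasRanksBelow, hs.arr_eq 4 hp]

section Rank

variable {P : Profile n} {m : Fin n} {s : State} {B : ℕ}

theorem runsIn_rankEntry (hB : 20 * (n * n) ≤ B) (hin : HoldsInput P m s) {v k : Fin n}
    (hv : s.reg 2 = v) (hk : s.reg 3 = k) :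
    RunsIn B (.write 4 (.index (.entry 1 (.reg 2) (.reg 3)) (.reg 2)) (.reg 3)) s fun s' t =>
      t ≤ 12 ∧ s' = s.setArr 4 (P.women v k * n + v) k := by
  have hn := Nat.le_mul_self n
  have hv_fits : (Expr.reg 2).Fits B s := hv.trans_le (by omega)
  have hk_fits : (Expr.reg 3).Fits B s := hk.trans_le (by omega)
  have hv_lt : (Expr.reg 2).eval s < n := hv.trans_lt v.is_lt
  have hk_lt : (Expr.reg 3).eval s < n := hk.trans_lt k.is_lt
  have hentry : s.arr 1 ((Expr.reg 2).eval s * n + (Expr.reg 3).eval s) = P.women v k := by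
    simpa only [Expr.eval, hv, hk] using hin.women_apply v k
  have heval := (Expr.eval_entry (a := 1) hin.reg_zero).trans hentry
  refine runsIn_write.2 ⟨.index hB hin.reg_zero ?_ ?_ hv_fits hv_lt, hk_fits, le_rfl, ?_⟩
  · exact .entry hB hin.reg_zero hv_fits hv_lt.le hk_fits hk_lt (by omega)
  · omega
  · rw [Expr.eval_index hin.reg_zero, heval, Expr.eval, Expr.eval, hv, hk]

theorem runsIn_rankColumnProg (hB : 20 * (n * n) ≤ B) (hin : HoldsInput P m s) {v : Fin n}
    (hv : s.reg 2 = v) (hs : HasRanksBelow P v s) :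
    RunsIn B rankColumnProg s fun s' t => t ≤ n * 20 + 6 ∧ HasRanksBelow P v s' ∧
      ∀ j : Fin n, s'.arr 4 (j * n + v) = (P.women v).pos j := by
  have hn := Nat.le_mul_self n
  refine (RunsIn.forLoop (T := 12)
    (I := fun k s' => HasRanksBelow P v s' ∧
      ∀ j : Fin n, (P.women v).pos j < k → s'.arr 4 (j * n + v) = (P.women v).pos j)
    (by decide) (by decide) (by decide) hin.reg_zero (by omega) (fun _ _ _ h => h)
    ⟨hs, fun j hj => absurd hj (Nat.not_lt_zero _)⟩ ?_).mono
    fun s' t ⟨ht, hlow, hcol⟩ => ⟨ht, hlow, fun j => hcol j ((P.women v).pos_lt j)⟩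
  rintro k s₁ hk hk₁ hframe ⟨hlow, hcol⟩
  have hv₁ : s₁.reg 2 = v := (hframe.reg_eq 2 (by decide)).trans hv
  refine (runsIn_rankEntry hB (hin.of_frame (by decide) hframe) hv₁ (k := ⟨k, hk⟩) hk₁).mono ?_
  rintro _ t ⟨ht, rfl⟩
  refine ⟨ht, fun u hu j hj => ?_, fun j hj => ?_⟩
  · rw [State.arr_setArr_table _ _ _ _ _ u.is_lt v.is_lt, if_neg (by omega)]
    exact hlow u hu j hj
  · rw [State.arr_setArr_table _ _ _ _ _ v.is_lt v.is_lt]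
    split_ifs with h
    · rw [Fin.ext h.1, PrefList.pos_apply]
    · refine hcol j ((Nat.lt_succ_iff_lt_or_eq.1 hj).resolve_right fun hpos => h ?_)
      have hj_eq : (P.women v).symm j = ⟨k, hk⟩ := Fin.ext hpos
      rw [← hj_eq, Equiv.apply_symm_apply]
      exact ⟨rfl, rfl⟩

theorem runsIn_rankProg (hB : 20 * (n * n) ≤ B) (hin : HoldsInput P m s) :
    RunsIn B rankProg s fun s' t => t ≤ n * (n * 20 + 22) + 6 ∧ HasRanksBelow P n s' := by
  have hn := Nat.le_mul_self n
  refine RunsIn.forLoop (T := n * 20 + 14) (I := HasRanksBelow P)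
    (by decide) (by decide) (by decide) hin.reg_zero (by omega) (fun _ _ _ h => h)
    (fun v hv => absurd hv (Nat.not_lt_zero _)) ?_
  intro k s₁ hk hk₁ hframe hlow
  have hin₁ := hin.of_frame (by decide) hframe
  refine runsIn_seq.2 ((runsIn_rankColumnProg hB hin₁ (v := ⟨k, hk⟩) hk₁ hlow).frame.mono ?_)
  rintro s₂ t₂ ⟨hframe₂, ht₂, hlow₂, hcol₂⟩
  have hzero := (hin₁.of_frame (by decide) hframe₂).reg_zero
  have htwo : s₂.reg 2 = k := (hframe₂.reg_eq 2 (by decide)).trans hk₁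
  refine runsIn_seq.2 (runsIn_write.2 ⟨.index hB hzero ?_ hzero.le ?_ (htwo.trans_lt hk), ?_,
    runsIn_skip.2 ⟨?_, fun u hu j hj => ?_⟩⟩)
  · exact hzero.trans_le (by omega)
  · exact htwo.trans_le (by omega)
  · exact hzero.trans_le (by omega)
  · simp only [Expr.index, Expr.cost]
    omega
  · rw [Expr.eval_index hzero, Expr.eval, Expr.eval, hzero, htwo,
      State.arr_setArr_table _ _ _ _ _ u.is_lt hk]
    split_ifs with h
    · rw [h.1, PrefList.rank_dummy]
    · rcases Nat.lt_succ_iff_lt_or_eq.1 hu with hlt | heq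
      · exact hlow₂ u hlt j hj
      · obtain rfl : u = ⟨k, hk⟩ := Fin.ext heq
        have hj' : j < n := by omega
        rw [PrefList.rank, dif_pos hj']
        exact hcol₂ ⟨j, hj'⟩

end Rank

/-! ### Testing a woman -/

/-- The configuration of sequential deferred acceptance that is stored in a state. -/
def State.config (s : State) : Config where
  ptr := s.arr 5
  hold := s.arr 6
  cand := s.reg 4
  next := s.reg 5

section Test

variable {P : Profile n} {m w : Fin n} {k : ℕ} {s : State} {B : ℕ}

theorem runsIn_startProg (hB : 20 * (n * n) ≤ B) (hin : HoldsInput P m s) (hw : s.reg 2 = w) :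
    RunsIn B startProg s fun s' t => t ≤ n * 15 + 21 ∧ Config.RunInv P m w 0 s'.config := by
  have hn := Nat.le_mul_self n
  have hm := m.is_lt
  refine runsIn_seq.2 ((RunsIn.forLoop (N := n) (T := 7)
    (I := fun k s' => ∀ j < k, s'.arr 5 j = 0 ∧ s'.arr 6 j = n)
    (by decide) (by decide) (by decide) hin.reg_zero (by omega) (fun _ _ _ h => h)
    (fun j hj => absurd hj (Nat.not_lt_zero j)) ?_).frame.mono ?_)
  · intro k s' hk hk' hframe hs'
    have hzero := (hin.of_frame (by decide) hframe).reg_zero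
    simp only [Prog.block, List.foldr, runsIn_seq, runsIn_write, runsIn_skip, Expr.Fits, Expr.eval,
      Expr.cost, State.reg_setArr, State.arr_setArr, hk', hzero]
    refine ⟨by omega, by omega, by omega, by omega, le_rfl, fun j hj => ?_⟩
    have := hs' j
    grind
  · rintro s' t ⟨hframe, ht, hs'⟩
    have hin' := hin.of_frame (by decide) hframe
    have hw' : s'.reg 2 = w := (hframe.reg_eq 2 (by decide)).trans hw
    simp only [List.foldr, runsIn_seq, runsIn_write, runsIn_assign, runsIn_skip, Expr.Fits,
      Expr.eval, Expr.cost, State.reg_setArr, hin'.reg_zero, hin'.reg_one, hw']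
    refine ⟨by omega, by omega, by omega, by omega, by omega, by omega, by omega, by omega,
      by omega, ?_⟩
    exact Config.runInv_start (fun j hj => (hs' j hj).1) fun x hx => (hs' x hx).2

theorem runsIn_swapProg (hx : s.reg 6 ≤ B) (hcand : s.reg 4 ≤ B) (hhold : s.arr 6 (s.reg 6) ≤ B) :
    RunsIn B swapProg s fun s' t => t ≤ 9 ∧ s'.config = s.config.swap (s.reg 6) :=
  runsIn_seq.2 <| runsIn_assign.2 ⟨⟨hx, hhold⟩, runsIn_seq.2 <| runsIn_write.2 ⟨hx, hcand,
    runsIn_seq.2 <| runsIn_assign.2 ⟨hhold, runsIn_skip.2 ⟨by decide, rfl⟩⟩⟩⟩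

theorem runsIn_bumpProg (hcand : s.reg 4 ≤ B) (hptr : s.arr 5 (s.reg 4) < B) :
    RunsIn B bumpProg s fun s' t => t ≤ 6 ∧ s'.config = s.config.bump :=
  runsIn_write.2 ⟨hcand, ⟨⟨hcand, hptr.le⟩, Nat.one_le_of_lt hptr, hptr⟩, by decide, rfl⟩

theorem runsIn_compareProg (hB : 20 * (n * n) ≤ B) (hzero : s.reg 0 = n)
    (hranks : HasRanksBelow P n s) {x : Fin n} (hx : s.reg 6 = x) (hcand : s.reg 4 ≤ n)
    (hhold : s.arr 6 x ≤ n) :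
    RunsIn B compareProg s fun s' t => t ≤ 24 ∧ s'.config =
      if (P.women x).rank s.config.cand < (P.women x).rank (s.config.hold x) then
        s.config.swap x else s.config := by
  have hn := Nat.le_mul_self n
  have hfit (e : Expr) (he : e.Fits B s) (hle : e.eval s ≤ n) :
      (Expr.entry 4 e (.reg 6)).eval s = (P.women x).rank (e.eval s) ∧
        (Expr.entry 4 e (.reg 6)).Fits B s := by
    have hentry := hranks x x.is_lt _ hle
    have hrank := (P.women x).rank_le (e.eval s)
    refine ⟨by rw [Expr.eval_entry hzero, Expr.eval, hx, hentry],
      .entry hB hzero he hle (hx.trans_le (by omega)) (hx.trans_lt x.is_lt) ?_⟩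
    rw [Expr.eval, hx, hentry]
    omega
  have hx_le : s.reg 6 ≤ B := by omega
  obtain ⟨heval₁, hfits₁⟩ := hfit (.reg 4) (hcand.trans (by omega)) hcand
  obtain ⟨heval₂, hfits₂⟩ := hfit (.read 6 (.reg 6))
    ⟨hx_le, by rw [Expr.eval, hx]; omega⟩ (by rwa [Expr.eval, Expr.eval, hx])
  refine runsIn_cond.2 ⟨⟨hfits₁, hfits₂, ?_⟩, ?_⟩
  · simp only [Op.eval]
    split_ifs <;> omega
  · simp only [Expr.eval, heval₁, heval₂, hx, Op.eval]
    by_cases hlt : (P.women x).rank (s.reg 4) < (P.women x).rank (s.arr 6 x)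
    · rw [if_pos hlt, if_pos one_ne_zero]
      refine (runsIn_swapProg hx_le (by omega) (by rw [hx]; omega)).mono fun s' t ⟨ht, hs'⟩ => ?_
      rw [hx] at hs'
      exact ⟨Nat.add_le_add_left ht 15, hs'.trans (if_pos hlt).symm⟩
    · rw [if_neg hlt, if_neg (not_not.2 rfl), runsIn_skip]
      exact ⟨by decide, (if_neg hlt).symm⟩

theorem runsIn_advanceProg (hnext : s.reg 5 < B) :
    RunsIn B advanceProg s fun s' t => t ≤ 7 ∧ s'.config = s.config.advance :=
  runsIn_seq.2 <| runsIn_assign.2 ⟨hnext.le, runsIn_seq.2 <| runsIn_assign.2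
    ⟨⟨hnext.le, Nat.one_le_of_lt hnext, hnext⟩, runsIn_skip.2 ⟨by decide, rfl⟩⟩⟩

theorem runsIn_proposeProg (hB : 20 * (n * n) ≤ B) (hin : HoldsInput P m s)
    (hranks : HasRanksBelow P n s) (hinv : Config.RunInv P m w k s.config) (hk : k < 6 * n * n)
    {c i : Fin n} (hc : s.reg 4 = c) (hi : s.arr 5 c = i) :
    RunsIn B proposeProg s fun s' t =>
      t ≤ 50 ∧ s'.config = s.config.propose P (P.men c i) := by
  have hn := Nat.le_mul_self n
  have hassoc := mul_assoc 6 n n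
  have hc_fits : (Expr.reg 4).Fits B s := hc.trans_le (by omega)
  have hi_eval : (Expr.read 5 (.reg 4)).eval s = i := by rw [Expr.eval, Expr.eval, hc, hi]
  have hi_fits : (Expr.read 5 (.reg 4)).Fits B s := ⟨hc_fits, hi_eval.trans_le (by omega)⟩
  have hentry : (Expr.entry 0 (.reg 4) (.read 5 (.reg 4))).eval s = P.men c i := by
    rw [Expr.eval_entry hin.reg_zero, hi_eval, Expr.eval, hc, hin.men_apply]
  refine runsIn_seq.2 (runsIn_assign.2 ⟨.entry hB hin.reg_zero hc_fits hinv.inv.cand_le hi_fits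
    (hi_eval.trans_lt i.is_lt) ?_, ?_⟩)
  · rw [← Expr.eval_entry hin.reg_zero, hentry]
    omega
  rw [hentry]
  refine runsIn_seq.2 ((runsIn_compareProg (s := s.setReg 6 (P.men c i)) hB hin.reg_zero
    hranks rfl hinv.inv.cand_le (hinv.inv.hold_le _)).mono ?_)
  rintro s₁ t₁ ⟨ht₁, hs₁⟩
  have hcand : s₁.config.cand ≤ n := by
    rw [hs₁]
    split_ifs
    exacts [hinv.inv.hold_le _, hinv.inv.cand_le]
  have hptr : s₁.config.ptr = s.config.ptr := by
    rw [hs₁]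
    split_ifs <;> rfl
  have hptr_lt : s₁.arr 5 (s₁.reg 4) < B := by
    have := hinv.ptr_le _ hcand
    rw [← hptr] at this
    exact this.trans_lt (by omega)
  refine runsIn_seq.2 ((runsIn_bumpProg (hcand.trans (by omega)) hptr_lt).mono ?_)
  rintro s₂ t₂ ⟨ht₂, hs₂⟩
  refine runsIn_skip.2 ⟨?_, ?_⟩
  · have hcost : (Expr.entry 0 (.reg 4) (.read 5 (.reg 4))).cost = 7 := rfl
    omega
  · rw [hs₂, hs₁]
    rfl

theorem runsIn_stepProg (hB : 20 * (n * n) ≤ B) (hin : HoldsInput P m s)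
    (hranks : HasRanksBelow P n s) (hinv : Config.RunInv P m w k s.config) (hk : k < 6 * n * n) :
    RunsIn B stepProg s fun s' t => t ≤ 60 ∧ s'.config = s.config.step P := by
  have hn := Nat.le_mul_self n
  have hassoc := mul_assoc 6 n n
  have hzero := hin.reg_zero
  have hcand : s.reg 4 ≤ n := hinv.inv.cand_le
  have hnext : s.reg 5 ≤ n := hinv.inv.next_le
  have hptr : s.arr 5 (s.reg 4) ≤ n + k := hinv.ptr_le _ hcand
  have hdummy : n ≤ s.arr 5 n := hinv.inv.le_ptr_dummy
  simp only [stepProg, runsIn_cond, Expr.Fits, Expr.eval, Expr.cost, Op.eval, hzero, ne_eq,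
    ite_eq_right_iff, one_ne_zero, imp_false, not_not]
  refine ⟨by split_ifs <;> omega, ?_⟩
  by_cases hlt : s.arr 5 (s.reg 4) < n
  · have hcand_lt : s.reg 4 < n :=
      hcand.lt_of_ne fun heq => absurd hdummy (not_le.2 (heq ▸ hlt))
    have hproposes : s.config.cand < n ∧ s.config.ptr s.config.cand < n := ⟨hcand_lt, hlt⟩
    rw [if_pos hlt, Config.step, dif_pos hproposes]
    refine (runsIn_proposeProg hB hin hranks hinv hk (c := ⟨s.reg 4, hcand_lt⟩)
      (i := ⟨s.arr 5 (s.reg 4), hlt⟩) rfl rfl).mono ?_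
    rintro s' t ⟨ht, hs'⟩
    exact ⟨by omega, hs'⟩
  · have hnot : ¬(s.config.cand < n ∧ s.config.ptr s.config.cand < n) := fun h => hlt h.2
    rw [if_neg hlt, Config.step, dif_neg hnot]
    refine ⟨by split_ifs <;> omega, ?_⟩
    by_cases hlt' : s.reg 5 < n
    · rw [if_pos hlt']
      refine (runsIn_advanceProg (by omega)).mono ?_
      rintro s' t ⟨ht, hs'⟩
      exact ⟨by omega, hs'.trans (if_pos hlt').symm⟩
    · rw [if_neg hlt', runsIn_skip]
      exact ⟨by omega, (if_neg hlt').symm⟩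

theorem runsIn_stepLoop (hB : 20 * (n * n) ≤ B) (hin : HoldsInput P m s)
    (hranks : HasRanksBelow P n s) (hsteps : s.reg 8 = 6 * n * n)
    (hinv : Config.RunInv P m w 0 s.config) :
    RunsIn B (.forLoop 3 8 stepProg) s fun s' t =>
      t ≤ n * n * 408 + 6 ∧ s'.arr 6 w ≤ n ∧ (s'.arr 6 w = m ↔ w ∉ rejectors P m) := by
  have hassoc := mul_assoc 6 n n
  refine (RunsIn.forLoop (x := 3) (T := 60) (I := fun k s' => Config.RunInv P m w k s'.config)
    (by decide) (by decide) (by decide) hsteps (by omega) (fun _ _ _ h => h) hinv ?_).mono ?_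
  · intro k s₁ hk _ hframe hinv₁
    refine (runsIn_stepProg hB (hin.of_frame (by decide) hframe)
      (hranks.of_frame (by decide) hframe) hinv₁ hk).mono ?_
    rintro s₂ t ⟨ht, hs₂⟩
    exact ⟨ht, hs₂ ▸ hinv₁.step⟩
  · rintro s' t ⟨ht, hinv'⟩
    exact ⟨by omega, hinv'.inv.hold_le w, (not_iff_comm.1 hinv'.hold_ne_iff).symm⟩

/-- Array `3` holds the indicator function of `rejectors` at the women `v < k`. -/
def HoldsRejectorsBelow (P : Profile n) (m : Fin n) (k : ℕ) (s : State) : Prop :=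
  ∀ v : Fin n, v < k →
    (v ∈ rejectors P m → s.arr 3 v = 1) ∧ (v ∉ rejectors P m → s.arr 3 v = 0)

theorem runsIn_testProg (hB : 20 * (n * n) ≤ B) (hin : HoldsInput P m s)
    (hranks : HasRanksBelow P n s) (hw : s.reg 2 = w) (hsteps : s.reg 8 = 6 * n * n)
    (hs : HoldsRejectorsBelow P m w s) :
    RunsIn B testProg s fun s' t =>
      t ≤ n * n * 408 + n * 15 + 40 ∧ HoldsRejectorsBelow P m (w + 1) s' := by
  have hn := Nat.le_mul_self n
  refine runsIn_seq.2 ((runsIn_startProg hB hin hw).frame.mono ?_)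
  rintro s₁ t₁ ⟨hframe₁, ht₁, hinv₁⟩
  have hin₁ := hin.of_frame (by decide) hframe₁
  refine runsIn_seq.2 ((runsIn_stepLoop hB hin₁ (hranks.of_frame (by decide) hframe₁)
    ((hframe₁.reg_eq 8 (by decide)).trans hsteps) hinv₁).frame.mono ?_)
  rintro s₂ t₂ ⟨hframe₂, ht₂, hhold_le, hhold⟩
  have hw₂ : s₂.reg 2 = w :=
    (hframe₂.reg_eq 2 (by decide)).trans ((hframe₁.reg_eq 2 (by decide)).trans hw)
  have hlow : HoldsRejectorsBelow P m w s₂ := by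
    rwa [HoldsRejectorsBelow, hframe₂.arr_eq 3 (by decide), hframe₁.arr_eq 3 (by decide)]
  simp only [List.foldr, runsIn_seq, runsIn_write, runsIn_skip, Expr.Fits, Expr.eval, Expr.cost,
    Op.eval, hw₂, (hin₁.of_frame (by decide) hframe₂).reg_one]
  refine ⟨by omega, ⟨by omega, ⟨⟨by omega, by omega⟩, by omega, by split_ifs <;> omega⟩,
    by split_ifs <;> omega⟩, by omega, fun v hv => ?_⟩
  rw [State.arr_setArr]
  split_ifs with hv_eq hhold'
  · rw [Fin.ext hv_eq.2]
    exact ⟨fun hmem => absurd hmem (hhold.1 hhold'), fun _ => rfl⟩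
  · rw [Fin.ext hv_eq.2]
    exact ⟨fun _ => rfl, fun hmem => absurd (hhold.2 hmem) hhold'⟩
  · exact hlow v (by omega)

theorem runsIn_rejectProg (hB : 20 * (n * n) ≤ B) (hin : HoldsInput P m s)
    (hranks : HasRanksBelow P n s) :
    RunsIn B rejectProg s fun s' t =>
      t ≤ n * (n * n * 408 + n * 15 + 48) + 13 ∧ HoldsRejectorsBelow P m n s' := by
  have hn := Nat.le_mul_self n
  have hassoc := mul_assoc 6 n n
  have hn_pos := m.pos
  have hzero := hin.reg_zero
  have hin' : HoldsInput P m (s.setReg 8 (6 * n * n)) := ⟨hzero, hin.reg_one, hin.men, hin.women⟩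
  have hranks' : HasRanksBelow P n (s.setReg 8 (6 * n * n)) := hranks
  simp only [rejectProg, Prog.block, List.foldr, runsIn_seq, runsIn_assign, runsIn_skip, Expr.Fits,
    Expr.eval, Expr.cost, Op.eval, hzero]
  refine ⟨by omega, (RunsIn.forLoop (x := 2) (p := testProg) (T := n * n * 408 + n * 15 + 40)
    (I := HoldsRejectorsBelow P m) (by decide) (by decide) (by decide) hin'.reg_zero (by omega)
    (fun _ _ _ h => h) (fun v hv => absurd hv (Nat.not_lt_zero v)) ?_).mono ?_⟩
  · intro k s₁ hk hk₁ hframe hs₁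
    exact runsIn_testProg hB (hin'.of_frame (by decide) hframe)
      (hranks'.of_frame (by decide) hframe) (w := ⟨k, hk⟩) hk₁
      ((hframe.reg_eq 8 (by decide)).trans rfl) hs₁
  · rintro s' t ⟨ht, hs'⟩
    have ht' : t ≤ n * (n * n * 408 + n * 15 + 48) + 6 := ht
    exact ⟨by omega, hs'⟩

end Test

/-! ### The output -/

/-- Array `2` holds the list `L`, and register `4` its length. -/
def HoldsList (s : State) (L : List (Fin n)) : Prop :=
  s.reg 4 = L.length ∧ ∀ i (h : i < L.length), s.arr 2 i = L[i]

section Output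

variable {P : Profile n} {m : Fin n} {s : State} {B b : ℕ} {p : Fin n → Prop} [DecidablePred p]
  {L : List (Fin n)}

theorem runsIn_appendProg {v : Fin n} (hB : n ≤ B) (hs : HoldsList s L) (hL : L.length < B)
    (hv : s.reg 5 = v) :
    RunsIn B appendProg s fun s' t => t ≤ 8 ∧ HoldsList s' (L ++ [v]) := by
  have hlen : (L ++ [v]).length = L.length + 1 := List.length_append
  simp only [appendProg, Prog.block, List.foldr, runsIn_seq, runsIn_write, runsIn_assign,
    runsIn_skip, Expr.Fits, Expr.eval, Expr.cost, Op.eval, State.reg_setArr, hs.1, hv]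
  refine ⟨by omega, by omega, by omega, by omega, ?_, fun i hi => ?_⟩
  · rw [State.reg_setReg, if_pos rfl, hlen]
  rw [State.arr_setReg, State.arr_setArr, List.getElem_append]
  split_ifs with hend hlt hlt
  · omega
  · rw [List.getElem_singleton]
  · exact hs.2 i hlt
  · omega

theorem runsIn_collectStepProg (hB : 20 * (n * n) ≤ B) (hb : b ≤ B) (hin : HoldsInput P m s)
    {k : Fin n} (hk : s.reg 3 = k) (hle : s.arr 3 (P.men m k) ≤ B)
    (hp : s.arr 3 (P.men m k) = b ↔ p (P.men m k)) (hs : HoldsList s L) (hL : L.length < B) :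
    RunsIn B (collectStepProg b) s fun s' t =>
      t ≤ 30 ∧ HoldsList s' (L ++ [P.men m k].filter p) := by
  have hn := Nat.le_mul_self n
  have hzero := hin.reg_zero
  have hm_fits : (Expr.reg 1).Fits B s := hin.reg_one.trans_le (by omega)
  have hk_fits : (Expr.reg 3).Fits B s := hk.trans_le (by omega)
  have hentry : s.arr 0 ((Expr.reg 1).eval s * n + (Expr.reg 3).eval s) = P.men m k := by
    simpa only [Expr.eval, hin.reg_one, hk] using hin.men_apply m k
  refine runsIn_seq.2 (runsIn_assign.2 ⟨.entry hB hzero hm_fits (hin.reg_one.trans_le m.is_lt.le)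
    hk_fits (hk.trans_lt k.is_lt) (by omega), ?_⟩)
  rw [Expr.eval_entry hzero, hentry]
  have hcost : (Expr.entry 0 (.reg 1) (.reg 3)).cost = 6 := rfl
  simp only [List.foldr, runsIn_seq, runsIn_cond, runsIn_skip, Expr.Fits, Expr.eval, Expr.cost,
    Op.eval, State.reg_setReg, State.arr_setReg, if_true, hcost]
  refine ⟨by split_ifs <;> omega, ?_⟩
  rw [List.filter_singleton]
  by_cases hmem : s.arr 3 (P.men m k) = b
  · rw [if_pos (by rw [if_pos hmem]; exact one_ne_zero), decide_eq_true (hp.1 hmem), cond_true]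
    refine (runsIn_appendProg (s := s.setReg 5 (P.men m k)) (by omega) hs hL rfl).mono ?_
    rintro s' t ⟨ht, hs'⟩
    exact ⟨by omega, hs'⟩
  · rw [if_neg (by rw [if_neg hmem]; exact not_not.2 rfl), decide_eq_false (mt hp.2 hmem),
      cond_false, List.append_nil]
    exact ⟨by decide, hs⟩

theorem runsIn_collectProg (hB : 20 * (n * n) ≤ B) (hb : b ≤ B) (hin : HoldsInput P m s)
    (hle : ∀ v : Fin n, s.arr 3 v ≤ B) (hp : ∀ v : Fin n, s.arr 3 v = b ↔ p v)
    (hs : HoldsList s L) (hL : L.length ≤ n) :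
    RunsIn B (collectProg b) s fun s' t =>
      t ≤ n * 38 + 6 ∧ HoldsList s' (L ++ (List.ofFn (P.men m)).filter p) := by
  have hn := Nat.le_mul_self n
  refine (RunsIn.forLoop (x := 3) (p := collectStepProg b) (T := 30)
    (I := fun k s' => HoldsList s' (L ++ ((List.ofFn (P.men m)).take k).filter p))
    (by decide) (show 3 ∉ (collectStepProg 0).regs by decide)
    (show 0 ∉ (collectStepProg 0).regs by decide) hin.reg_zero (by omega) (fun _ _ _ h => h)
    (by simpa using hs) ?_).mono ?_
  · intro k s₁ hk hk₁ hframe hs₁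
    have hin₁ := hin.of_frame (p := collectProg b)
      (show (collectProg 0).KeepsInput by decide) hframe
    have harr := hframe.arr_eq 3 (show 3 ∉ (collectProg 0).arrs by decide)
    have hlen : (((List.ofFn (P.men m)).take k).filter p).length ≤ k :=
      (List.length_filter_le _ _).trans (List.length_take_le _ _)
    refine (runsIn_collectStepProg (p := p) hB hb hin₁ (k := ⟨k, hk⟩) hk₁ ?_ ?_ hs₁ ?_).mono ?_
    · rw [harr]
      exact hle _
    · rw [harr]
      exact hp _
    · rw [List.length_append]
      omega
    · rintro s₂ t ⟨ht, hs₂⟩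
      rw [List.take_succ_eq_append_getElem (by rwa [List.length_ofFn]), List.filter_append,
        ← List.append_assoc, List.getElem_ofFn]
      exact ⟨ht, hs₂⟩
  · rintro s' t ⟨ht, hs'⟩
    rw [List.take_of_length_le (List.length_ofFn.le)] at hs'
    exact ⟨ht, hs'⟩

variable {X : Set (Fin n)}

theorem OutputsSet.eq_one_iff (hX : OutputsSet s X) (v : Fin n) : s.arr 3 v = 1 ↔ v ∈ X :=
  ⟨fun h => by_contra fun hv => absurd (h.symm.trans ((hX v).2 hv)) one_ne_zero, (hX v).1⟩

theorem OutputsSet.eq_zero_iff (hX : OutputsSet s X) (v : Fin n) : s.arr 3 v = 0 ↔ v ∉ X :=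
  ⟨fun h hv => absurd (h.symm.trans ((hX v).1 hv)) zero_ne_one, (hX v).2⟩

theorem OutputsSet.le_one (hX : OutputsSet s X) (v : Fin n) : s.arr 3 v ≤ 1 := by
  by_cases hv : v ∈ X
  exacts [((hX v).1 hv).le, ((hX v).2 hv).trans_le zero_le_one]

open Classical in
theorem runsIn_pushUpProg (hB : 20 * (n * n) ≤ B) (hin : HoldsInput P m s) (hX : OutputsSet s X) :
    RunsIn B pushUpProg s fun s' t =>
      t ≤ n * 76 + 20 ∧ OutputsList s' (pushUp (P.men m) X) ∧
        s'.reg 6 = frontLength (P.men m) X := by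
  have hn := Nat.le_mul_self n
  have hB_pos : 1 ≤ B := Nat.one_le_iff_ne_zero.2 fun h => by have := m.pos; omega
  have hle (v : Fin n) : s.arr 3 v ≤ B := (hX.le_one v).trans hB_pos
  have hin₀ : HoldsInput P m (s.setReg 4 0) := ⟨hin.reg_zero, hin.reg_one, hin.men, hin.women⟩
  have hnil : HoldsList (n := n) (s.setReg 4 0) [] :=
    ⟨rfl, fun i hi => absurd hi (Nat.not_lt_zero i)⟩
  refine runsIn_seq.2 (runsIn_assign.2 ⟨Nat.zero_le B, runsIn_seq.2
    ((runsIn_collectProg hB hB_pos hin₀ hle hX.eq_one_iff hnil (Nat.zero_le n)).frame.mono ?_)⟩)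
  rintro s₁ t₁ ⟨hframe₁, ht₁, hs₁⟩
  have hfront : s₁.reg 4 = frontLength (P.men m) X := hs₁.1
  have hfront_le : frontLength (P.men m) X ≤ n :=
    (List.length_filter_le _ _).trans_eq List.length_ofFn
  have hin₁ := hin₀.of_frame (by decide) hframe₁
  have harr₁ : s₁.arr 3 = s.arr 3 := hframe₁.arr_eq 3 (by decide)
  refine runsIn_seq.2 (runsIn_assign.2 ⟨show s₁.reg 4 ≤ B by omega, runsIn_seq.2
    ((runsIn_collectProg (s := s₁.setReg 6 (s₁.reg 4)) (p := (· ∉ X)) hB (Nat.zero_le B)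
      ⟨hin₁.reg_zero, hin₁.reg_one, hin₁.men, hin₁.women⟩ (harr₁ ▸ hle)
      (harr₁ ▸ hX.eq_zero_iff) hs₁ hfront_le).frame.mono ?_)⟩)
  rintro s₂ t₂ ⟨hframe₂, ht₂, hs₂⟩
  refine runsIn_skip.2 ⟨?_, fun k => hs₂.2 k _, (hframe₂.reg_eq 6 (by decide)).trans hfront⟩
  simp only [Expr.cost]
  omega

theorem runsIn_addPartnerProg {a : Fin n} {σ : PrefList n} (hB : n ≤ B) (hσ : OutputsList s σ)
    (ha : s.reg 6 = σ.pos a) (hX : OutputsSet s X) :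
    RunsIn B addPartnerProg s fun s' t =>
      t ≤ 5 ∧ OutputsList s' σ ∧ OutputsSet s' (insert a X) := by
  have hpos := σ.pos_lt a
  have hpartner : s.arr 2 (s.reg 6) = a := by
    have := hσ (σ.symm a)
    rwa [Equiv.apply_symm_apply, ← PrefList.pos, ← ha] at this
  refine runsIn_write.2 ⟨⟨show s.reg 6 ≤ B by omega, ?_⟩, show 1 ≤ B by omega, by decide, hσ,
    fun v => ?_⟩
  · exact hpartner.trans_le (by omega)
  · simp only [Expr.eval, hpartner, State.arr_setArr, true_and, Fin.val_inj, Set.mem_insert_iff]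
    split_ifs with hv
    · exact ⟨fun _ => rfl, fun h => absurd (Or.inl hv) h⟩
    · rw [or_iff_right hv]
      exact hX v

theorem runsIn_oneForAllProg (hB : 20 * (n * n) ≤ B) (P : Profile n) (m : Fin n) :
    RunsIn B oneForAllProg (inputState P m) fun s t => t ≤ 1000 * n ^ 3 ∧
      OutputsList s (pushUp (P.men m) (rejectors P m)) ∧ OutputsSet s (noRegretSet P m) := by
  have hn := Nat.le_mul_self n
  have hin := holdsInput_inputState P m
  refine runsIn_seq.2 ((runsIn_rankProg hB hin).frame.mono ?_)
  rintro s₁ t₁ ⟨hframe₁, ht₁, hranks⟩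
  have hin₁ := hin.of_frame (by decide) hframe₁
  refine runsIn_seq.2 ((runsIn_rejectProg hB hin₁ hranks).frame.mono ?_)
  rintro s₂ t₂ ⟨hframe₂, ht₂, hset₂⟩
  have hrejectors₂ : OutputsSet s₂ (rejectors P m) := fun v => hset₂ v v.is_lt
  refine runsIn_seq.2 ((runsIn_pushUpProg hB (hin₁.of_frame (by decide) hframe₂)
    hrejectors₂).frame.mono ?_)
  rintro s₃ t₃ ⟨hframe₃, ht₃, hlist₃, hfront⟩
  have hrejectors₃ : OutputsSet s₃ (rejectors P m) := by
    rwa [OutputsSet, hframe₃.arr_eq 3 (by decide)]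
  have hpos := pos_pushUp (P.men m) (DA_notMem_rejectors P m)
    fun _ => mem_rejectors_of_prefers_DA
  refine runsIn_seq.2 ((runsIn_addPartnerProg (by omega) hlist₃ (hfront.trans hpos.symm)
    hrejectors₃).mono ?_)
  rintro s₄ t₄ ⟨ht₄, hlist₄, hset₄⟩
  refine runsIn_skip.2 ⟨?_, hlist₄, (noRegretSet_eq_insert_rejectors P m).symm ▸ hset₄⟩
  have hsq : n * n ≤ n ^ 3 := by
    rw [pow_succ, sq]
    exact Nat.le_mul_of_pos_right _ m.pos
  have hrank : n * (n * 20 + 22) = 20 * (n * n) + 22 * n := by ring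
  have hreject : n * (n * n * 408 + n * 15 + 48) = 408 * n ^ 3 + 15 * (n * n) + 48 * n := by ring
  have hn_pos := m.pos
  omega

end Output

end OneForAll

theorem mainTheorem4 :
    ∃ (prog : OneForAll.Prog) (C : ℕ),
      ∀ (n : ℕ) (P : OneForAll.Profile n) (m : Fin n),
        ∃ (s : OneForAll.State) (t : ℕ) (σ : OneForAll.PrefList n),
          OneForAll.Exec (C * n ^ 2) prog (OneForAll.inputState P m) s t ∧
          t ≤ C * n ^ 3 ∧
          OneForAll.OutputsList s σ ∧
          OneForAll.OutputsSet s (OneForAll.noRegretSet P m) ∧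
          OneForAll.IsPushUp P m (OneForAll.noRegretSet P m) σ ∧
          OneForAll.IsOptimalStrategy P m σ := by
  refine ⟨OneForAll.oneForAllProg, 1000, fun n P m => ?_⟩
  have hB : 20 * (n * n) ≤ 1000 * n ^ 2 := by rw [sq]; omega
  obtain ⟨s, t, hexec, ht, hlist, hset⟩ := OneForAll.runsIn_oneForAllProg hB P m
  have hσ := OneForAll.pushUp_prefers_iff (P.men m) (OneForAll.DA_notMem_rejectors P m)
    fun _ => OneForAll.mem_rejectors_of_prefers_DA
  exact ⟨s, t, _, hexec, ht, hlist, hset, OneForAll.isPushUp_of_prefers_iff hσ,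
    OneForAll.isOptimalStrategy_of_prefers_iff hσ⟩
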